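/- A \emph{weighted oriented one-foam} is a finite oriented graph (circles without vertices are allowed as components) whose vertices are trivalent, each being either a \emph{merge} (two thin edges in, one thick edge out) or a \emph{split} (one thick edge in, two thin edges out), together with an order of the two thin edges at each vertex and a weight in $\mathbb R_{>0}$ on each edge such that at each vertex the weights of the thin edges add up to the weight of the thick edge. A \emph{weighted oriented two-foam} is a compact two-dimensional combinatorial complex with oriented weighted facets. Along each of its seams two ordered thin facets, inducing the same direction on the seam, flow into a thick facet, which induces the opposite direction; the weights of the thin facets add up to that of the thick one. At each of its vertices six facets $f_1,f_2,f_3,f_{12},f_{23},f_{123}$ meet along four seams with (thin, thin; thick) facets $(f_1,f_2;f_{12})$, $(f_2,f_3;f_{23})$, $(f_{12},f_3;f_{123})$, $(f_1,f_{23};f_{123})$, with the thin facets either all ordered as listed or all ordered in the opposite way. Its boundary is a weighted oriented one-foam. One-foams $U_0,U_1$ are \emph{cobordant} if $(-U_0)\sqcup U_1$ bounds a weighted oriented two-foam; the cobordism classes form an abelian group $\mathsf{Cob}^1_{>0}$ under disjoint union, with inverse given by orientation reversal. For $r\ge 1$, $\lambda_1,\dots,\lambda_r>0$ with $\sum_i\lambda_i=1$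 and $\sigma\in S_r$, let $T_{\lambda,\sigma}:[0,1)\to[0,1)$ be the interval exchange transformation that cuts $[0,1)$ into consecutive half-open intervals of lengths $\lambda_1,\dots,\lambda_r$ and makes the $i$-th interval $\sigma(i)$-th in the new order. Let $\mathsf{Aut}_{\mathsf{IET}}$ be the group of all these bijections under composition. The closed one-foam $\widehat F_{\lambda,\sigma}$ is obtained from a line of weight $1$ by splitting it, through any sequence of binary splits, into lines of weights $\lambda_1,\dots,\lambda_r$ from left to right, permuting these lines by $\sigma$, merging them, through any sequence of binary merges of neighbours, into a line of weight $1$, and closing up this line with the initial one; thin edges are ordered from left to right. \textbf{Proposition.} (1) If $T_{\lambda'',\sigma''}=T_{\lambda',\sigma'}\circ T_{\lambda,\sigma}$, then $\widehat F_{\lambda'',\sigma''}$ is cobordant to $\widehat F_{\lambda,\sigma}\sqcup\widehat F_{\lambda',\sigma'}$, for all choices of the sequences of splits and merges. (2) There is a group homomorphism $\phi':\mathsf{Aut}_{\mathsf{IET}}\to\mathsf{Cob}^1_{>0}$ with $\phi'(T_{\lambda,\sigma})=[\widehat F_{\lambda,\sigma}]$ for all $(\lambda,\sigma)$ and all choices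 of the sequences of splits and merges. -/

import Mathlib

/-! ### Weighted oriented one-foams -/

/-- A closed weighted (that is, `ℝ_{>0}`-decorated) oriented one-foam, as a finite combinatorial
complex: a finite oriented graph, with loops and multiple edges allowed, in which every vertex is
* a bivalent point (`Reg`; one edge comes in, one goes out), which is only a marking on a line or
  on a circle, so that a circle without vertices is an edge whose two ends meet in such a point;
* a merge vertex (`Merge`), with an ordered pair of thin edges coming in and a thick edge going
  out; or
* a split vertex (`Split`), with a thick edge coming in and an ordered pair of thin edges going
  out.
Each edge carries a positive weight; weights add at the vertices. -/
structure OneFoam where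
  Edge : Type
  Reg : Type
  Merge : Type
  Split : Type
  [finite_edge : Finite Edge]
  [finite_reg : Finite Reg]
  [finite_merge : Finite Merge]
  [finite_split : Finite Split]
  weight : Edge → ℝ
  weight_pos : ∀ e, 0 < weight e
  regIn : Reg → Edge
  regOut : Reg → Edge
  mergeIn₁ : Merge → Edge
  mergeIn₂ : Merge → Edge
  mergeOut : Merge → Edge
  splitIn : Split → Edge
  splitOut₁ : Split → Edge
  splitOut₂ : Split → Edge
  /-- every edge has exactly one terminal end -/
  target_bij : Function.Bijective
    (Sum.elim regIn (Sum.elim mergeIn₁ (Sum.elim mergeIn₂ splitIn)))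
  /-- every edge has exactly one initial end -/
  source_bij : Function.Bijective
    (Sum.elim regOut (Sum.elim splitOut₁ (Sum.elim splitOut₂ mergeOut)))
  reg_weight : ∀ r, weight (regIn r) = weight (regOut r)
  merge_weight : ∀ m, weight (mergeIn₁ m) + weight (mergeIn₂ m) = weight (mergeOut m)
  split_weight : ∀ s, weight (splitOut₁ s) + weight (splitOut₂ s) = weight (splitIn s)

namespace OneFoam

attribute [instance] OneFoam.finite_edge OneFoam.finite_reg OneFoam.finite_merge
  OneFoam.finite_split

/-- The empty one-foam. -/
def empty : OneFoam where
  Edge := Empty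
  Reg := Empty
  Merge := Empty
  Split := Empty
  weight := Empty.elim
  weight_pos := fun e => e.elim
  regIn := Empty.elim
  regOut := Empty.elim
  mergeIn₁ := Empty.elim
  mergeIn₂ := Empty.elim
  mergeOut := Empty.elim
  splitIn := Empty.elim
  splitOut₁ := Empty.elim
  splitOut₂ := Empty.elim
  target_bij := ⟨by rintro (x | x | x | x) <;> exact x.elim, fun e => e.elim⟩
  source_bij := ⟨by rintro (x | x | x | x) <;> exact x.elim, fun e => e.elim⟩
  reg_weight := fun e => e.elim
  merge_weight := fun e => e.elim
  split_weight := fun e => e.elim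

/-- The one-foam `-U`: all edges are reversed, so that merges become splits and vice versa; the
order of the two thin edges at each vertex and the weights stay the same. -/
def reverse (U : OneFoam) : OneFoam where
  Edge := U.Edge
  Reg := U.Reg
  Merge := U.Split
  Split := U.Merge
  weight := U.weight
  weight_pos := U.weight_pos
  regIn := U.regOut
  regOut := U.regIn
  mergeIn₁ := U.splitOut₁
  mergeIn₂ := U.splitOut₂
  mergeOut := U.splitIn
  splitIn := U.mergeOut
  splitOut₁ := U.mergeIn₁
  splitOut₂ := U.mergeIn₂
  target_bij := U.source_bij
  source_bij := U.target_bij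
  reg_weight := fun r => (U.reg_weight r).symm
  merge_weight := U.split_weight
  split_weight := U.merge_weight

/-- Bookkeeping for disjoint unions. -/
theorem bij_sum {A B C D E A' B' C' D' E' : Type} {a : A → E} {b : B → E} {c : C → E} {d : D → E}
    {a' : A' → E'} {b' : B' → E'} {c' : C' → E'} {d' : D' → E'}
    (h : Function.Bijective (Sum.elim a (Sum.elim b (Sum.elim c d))))
    (h' : Function.Bijective (Sum.elim a' (Sum.elim b' (Sum.elim c' d')))) :
    Function.Bijective (Sum.elim (Sum.map a a') (Sum.elim (Sum.map b b')
      (Sum.elim (Sum.map c c') (Sum.map d d')))) := by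
  let e : (A ⊕ A') ⊕ ((B ⊕ B') ⊕ ((C ⊕ C') ⊕ (D ⊕ D'))) ≃
      (A ⊕ (B ⊕ (C ⊕ D))) ⊕ (A' ⊕ (B' ⊕ (C' ⊕ D'))) :=
    (Equiv.sumCongr (Equiv.refl _) ((Equiv.sumCongr (Equiv.refl _)
      (Equiv.sumSumSumComm _ _ _ _)).trans (Equiv.sumSumSumComm _ _ _ _))).trans
      (Equiv.sumSumSumComm _ _ _ _)
  have hb := (Function.Bijective.sumMap h h').comp e.bijective
  convert hb using 1
  funext x
  rcases x with (x | x) | (x | x) | (x | x) | (x | x) <;> rfl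

/-- The disjoint union of two one-foams. -/
def union (U V : OneFoam) : OneFoam where
  Edge := U.Edge ⊕ V.Edge
  Reg := U.Reg ⊕ V.Reg
  Merge := U.Merge ⊕ V.Merge
  Split := U.Split ⊕ V.Split
  weight := Sum.elim U.weight V.weight
  weight_pos := by rintro (e | e); exacts [U.weight_pos e, V.weight_pos e]
  regIn := Sum.map U.regIn V.regIn
  regOut := Sum.map U.regOut V.regOut
  mergeIn₁ := Sum.map U.mergeIn₁ V.mergeIn₁
  mergeIn₂ := Sum.map U.mergeIn₂ V.mergeIn₂
  mergeOut := Sum.map U.mergeOut V.mergeOut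
  splitIn := Sum.map U.splitIn V.splitIn
  splitOut₁ := Sum.map U.splitOut₁ V.splitOut₁
  splitOut₂ := Sum.map U.splitOut₂ V.splitOut₂
  target_bij := bij_sum U.target_bij V.target_bij
  source_bij := bij_sum U.source_bij V.source_bij
  reg_weight := by rintro (e | e); exacts [U.reg_weight e, V.reg_weight e]
  merge_weight := by rintro (e | e); exacts [U.merge_weight e, V.merge_weight e]
  split_weight := by rintro (e | e); exacts [U.split_weight e, V.split_weight e]

/-- Isomorphisms of one-foams (used only to prove the group laws below). -/
structure Iso (U V : OneFoam) where
  edge : U.Edge ≃ V.Edge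
  reg : U.Reg ≃ V.Reg
  merge : U.Merge ≃ V.Merge
  split : U.Split ≃ V.Split
  weight : ∀ e, V.weight (edge e) = U.weight e
  regIn : ∀ x, V.regIn (reg x) = edge (U.regIn x)
  regOut : ∀ x, V.regOut (reg x) = edge (U.regOut x)
  mergeIn₁ : ∀ x, V.mergeIn₁ (merge x) = edge (U.mergeIn₁ x)
  mergeIn₂ : ∀ x, V.mergeIn₂ (merge x) = edge (U.mergeIn₂ x)
  mergeOut : ∀ x, V.mergeOut (merge x) = edge (U.mergeOut x)
  splitIn : ∀ x, V.splitIn (split x) = edge (U.splitIn x)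
  splitOut₁ : ∀ x, V.splitOut₁ (split x) = edge (U.splitOut₁ x)
  splitOut₂ : ∀ x, V.splitOut₂ (split x) = edge (U.splitOut₂ x)

end OneFoam

/-! ### Weighted oriented two-foams -/

/-- The six facets `f₁, f₂, f₃, f₁₂, f₂₃, f₁₂₃` at a vertex of a two-foam fit together along the
four seams `a, b, c, d` there. The triples (first thin, second thin, thick facet) along the seams
are `(f₁, f₂, f₁₂)` for `a`, `(f₂, f₃, f₂₃)` for `b`, `(f₁₂, f₃, f₁₂₃)` for `c` and
`(f₁, f₂₃, f₁₂₃)` for `d`. -/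
def VertexMatch {Seam Facet : Type} (thin₁ thin₂ thick : Seam → Facet) (a b c d : Seam) : Prop :=
  thin₁ a = thin₁ d ∧ thin₂ a = thin₁ b ∧ thin₂ b = thin₂ c ∧
    thick a = thin₁ c ∧ thick b = thin₂ d ∧ thick c = thick d

/-- A compact weighted oriented two-foam with boundary (identified with) the one-foam `U`,
described combinatorially by its seams, its vertices and its facets.

Facets. A facet is (the interior of) a compact connected oriented surface, and hence is given by
its genus and by its boundary circles. The boundary circles are subdivided into sides; a side runs
either along a seam or along an edge of `U`. Along each seam there are three sides, which belong to
the first thin, the second thin and the thick facet. `thin₁`, `thin₂`, `thick` and `side` record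
the facet to which a side belongs. Sides are directed by the boundary orientation of their facet.

Seams. The two thin facets induce the same direction on the seam, and the thick one induces the
opposite direction (each thin facet flows into the thick facet). A seam is directed like its two
thin sides. Its terminal end and its initial end lie at
* a bivalent point of the seam (`Point`), a mere marking, where a seam ends and a seam starts; a
  seam circle without vertices is a seam with one such point on it;
* a vertex. There are two kinds of vertices up to isomorphism. With the notation of `VertexMatch`,
  at a vertex in `VertP` the seams `a, c` end and the seams `b, d` start; at a vertex in `VertN`
  all facet orientations are opposite, so that `a, c` start and `b, d` end. (Reversing the
  order of the thin facets along all four seams exchanges the two kinds.)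
* a vertex of the boundary `U`: seams end at the splits of `U` and start at its merges.

Where two sides meet. At each of these points every arriving side is followed by the departing side
in the same corner. So the cyclic sequences of sides that bound the facets are determined by the
kinds of points, and what has to be required is that two consecutive sides belong to the same
facet. -/
structure TwoFoam (U : OneFoam) where
  Facet : Type
  Seam : Type
  Point : Type
  VertP : Type
  VertN : Type
  [finite_facet : Finite Facet]
  [finite_seam : Finite Seam]
  [finite_point : Finite Point]
  [finite_vertP : Finite VertP]
  [finite_vertN : Finite VertN]
  genus : Facet → ℕ
  weight : Facet → ℝ
  weight_pos : ∀ f, 0 < weight f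
  thin₁ : Seam → Facet
  thin₂ : Seam → Facet
  thick : Seam → Facet
  seam_weight : ∀ s, weight (thin₁ s) + weight (thin₂ s) = weight (thick s)
  side : U.Edge → Facet
  side_weight : ∀ e, weight (side e) = U.weight e
  pointIn : Point → Seam
  pointOut : Point → Seam
  aP : VertP → Seam
  bP : VertP → Seam
  cP : VertP → Seam
  dP : VertP → Seam
  aN : VertN → Seam
  bN : VertN → Seam
  cN : VertN → Seam
  dN : VertN → Seam
  atSplit : U.Split → Seam
  atMerge : U.Merge → Seam
  /-- every seam has exactly one terminal end -/
  target_bij : Function.Bijective (Sum.elim pointIn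
    (Sum.elim aP (Sum.elim cP (Sum.elim bN (Sum.elim dN atSplit)))))
  /-- every seam has exactly one initial end -/
  source_bij : Function.Bijective (Sum.elim pointOut
    (Sum.elim aN (Sum.elim cN (Sum.elim bP (Sum.elim dP atMerge)))))
  /-- the facets continue along the seam, in the same order -/
  point_match : ∀ p, thin₁ (pointIn p) = thin₁ (pointOut p) ∧
    thin₂ (pointIn p) = thin₂ (pointOut p) ∧ thick (pointIn p) = thick (pointOut p)
  vertP_match : ∀ v, VertexMatch thin₁ thin₂ thick (aP v) (bP v) (cP v) (dP v)
  vertN_match : ∀ v, VertexMatch thin₁ thin₂ thick (aN v) (bN v) (cN v) (dN v)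
  reg_match : ∀ r, side (U.regIn r) = side (U.regOut r)
  merge_match : ∀ m, side (U.mergeIn₁ m) = thin₁ (atMerge m) ∧
    side (U.mergeIn₂ m) = thin₂ (atMerge m) ∧ side (U.mergeOut m) = thick (atMerge m)
  split_match : ∀ s, side (U.splitOut₁ s) = thin₁ (atSplit s) ∧
    side (U.splitOut₂ s) = thin₂ (atSplit s) ∧ side (U.splitIn s) = thick (atSplit s)

/-- A cobordism from `U` to `V` is a two-foam with boundary `(-U) ⊔ V`; two one-foams are
cobordant if there is one. -/
def Cobordant (U V : OneFoam) : Prop :=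
  Nonempty (TwoFoam (U.reverse.union V))

namespace TwoFoam

attribute [instance] TwoFoam.finite_facet TwoFoam.finite_seam TwoFoam.finite_point
  TwoFoam.finite_vertP TwoFoam.finite_vertN

/-- Change the boundary by an isomorphism. -/
def transport {U V : OneFoam} (i : U.Iso V) (F : TwoFoam U) : TwoFoam V where
  Facet := F.Facet
  Seam := F.Seam
  Point := F.Point
  VertP := F.VertP
  VertN := F.VertN
  genus := F.genus
  weight := F.weight
  weight_pos := F.weight_pos
  thin₁ := F.thin₁
  thin₂ := F.thin₂
  thick := F.thick
  seam_weight := F.seam_weight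
  side := fun e => F.side (i.edge.symm e)
  side_weight := fun e => by rw [F.side_weight, ← i.weight, Equiv.apply_symm_apply]
  pointIn := F.pointIn
  pointOut := F.pointOut
  aP := F.aP
  bP := F.bP
  cP := F.cP
  dP := F.dP
  aN := F.aN
  bN := F.bN
  cN := F.cN
  dN := F.dN
  atSplit := fun s => F.atSplit (i.split.symm s)
  atMerge := fun s => F.atMerge (i.merge.symm s)
  target_bij := by
    have := F.target_bij.comp (Equiv.sumCongr (Equiv.refl _) (Equiv.sumCongr (Equiv.refl _)
      (Equiv.sumCongr (Equiv.refl _) (Equiv.sumCongr (Equiv.refl _) (Equiv.sumCongr (Equiv.refl _)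
      i.split.symm))))).bijective
    convert this using 1
    funext x
    rcases x with x | x | x | x | x | x <;> rfl
  source_bij := by
    have := F.source_bij.comp (Equiv.sumCongr (Equiv.refl _) (Equiv.sumCongr (Equiv.refl _)
      (Equiv.sumCongr (Equiv.refl _) (Equiv.sumCongr (Equiv.refl _) (Equiv.sumCongr (Equiv.refl _)
      i.merge.symm))))).bijective
    convert this using 1
    funext x
    rcases x with x | x | x | x | x | x <;> rfl
  point_match := F.point_match
  vertP_match := F.vertP_match
  vertN_match := F.vertN_match
  reg_match := fun r => by
    obtain ⟨r, rfl⟩ := i.reg.surjective r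
    simpa [i.regIn, i.regOut] using F.reg_match r
  merge_match := fun r => by
    obtain ⟨r, rfl⟩ := i.merge.surjective r
    simpa [i.mergeIn₁, i.mergeIn₂, i.mergeOut] using F.merge_match r
  split_match := fun r => by
    obtain ⟨r, rfl⟩ := i.split.surjective r
    simpa [i.splitOut₁, i.splitOut₂, i.splitIn] using F.split_match r

/-- Reverse the orientations of all facets. -/
def reverse {U : OneFoam} (F : TwoFoam U) : TwoFoam U.reverse where
  Facet := F.Facet
  Seam := F.Seam
  Point := F.Point
  VertP := F.VertN
  VertN := F.VertP
  genus := F.genus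
  weight := F.weight
  weight_pos := F.weight_pos
  thin₁ := F.thin₁
  thin₂ := F.thin₂
  thick := F.thick
  seam_weight := F.seam_weight
  side := F.side
  side_weight := F.side_weight
  pointIn := F.pointOut
  pointOut := F.pointIn
  aP := F.aN
  bP := F.bN
  cP := F.cN
  dP := F.dN
  aN := F.aP
  bN := F.bP
  cN := F.cP
  dN := F.dP
  atSplit := F.atMerge
  atMerge := F.atSplit
  target_bij := F.source_bij
  source_bij := F.target_bij
  point_match := fun p => by simpa [eq_comm] using F.point_match p
  vertP_match := F.vertN_match
  vertN_match := F.vertP_match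
  reg_match := fun r => (F.reg_match r).symm
  merge_match := F.split_match
  split_match := F.merge_match

/-- Bookkeeping for disjoint unions and gluings. -/
theorem bij_sum {A B C D E G A' B' C' D' E' G' S S' : Type} {a : A → S} {b : B → S} {c : C → S}
    {d : D → S} {e : E → S} {g : G → S} {a' : A' → S'} {b' : B' → S'} {c' : C' → S'} {d' : D' → S'}
    {e' : E' → S'} {g' : G' → S'}
    (h : Function.Bijective (Sum.elim a (Sum.elim b (Sum.elim c (Sum.elim d (Sum.elim e g))))))
    (h' : Function.Bijective
      (Sum.elim a' (Sum.elim b' (Sum.elim c' (Sum.elim d' (Sum.elim e' g')))))) :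
    Function.Bijective (Sum.elim (Sum.map a a') (Sum.elim (Sum.map b b')
      (Sum.elim (Sum.map c c') (Sum.elim (Sum.map d d') (Sum.elim (Sum.map e e')
        (Sum.map g g')))))) := by
  have hb := (Function.Bijective.sumMap h h').comp
    ((Equiv.sumCongr (Equiv.refl _) ((Equiv.sumCongr (Equiv.refl _)
      ((Equiv.sumCongr (Equiv.refl _) ((Equiv.sumCongr (Equiv.refl _)
      (Equiv.sumSumSumComm _ _ _ _)).trans (Equiv.sumSumSumComm _ _ _ _))).trans
      (Equiv.sumSumSumComm _ _ _ _))).trans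
      (Equiv.sumSumSumComm _ _ _ _))).trans
      (Equiv.sumSumSumComm _ _ _ _)).bijective
  convert hb using 1
  funext x
  rcases x with (x | x) | (x | x) | (x | x) | (x | x) | (x | x) | (x | x) <;> rfl

theorem vertexMatch_map {S S' T T' : Type} {f₁ f₂ f₃ : S → T} {g₁ g₂ g₃ : S' → T'} {j : S → S'}
    {k : T → T'} (h₁ : ∀ s, g₁ (j s) = k (f₁ s)) (h₂ : ∀ s, g₂ (j s) = k (f₂ s))
    (h₃ : ∀ s, g₃ (j s) = k (f₃ s)) {a b c d : S} (h : VertexMatch f₁ f₂ f₃ a b c d) :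
    VertexMatch g₁ g₂ g₃ (j a) (j b) (j c) (j d) := by
  obtain ⟨e₁, e₂, e₃, e₄, e₅, e₆⟩ := h
  refine ⟨?_, ?_, ?_, ?_, ?_, ?_⟩ <;> simp only [h₁, h₂, h₃]
  exacts [congrArg k e₁, congrArg k e₂, congrArg k e₃, congrArg k e₄, congrArg k e₅, congrArg k e₆]

/-- The disjoint union of two-foams. -/
def union {U V : OneFoam} (F : TwoFoam U) (G : TwoFoam V) : TwoFoam (U.union V) where
  Facet := F.Facet ⊕ G.Facet
  Seam := F.Seam ⊕ G.Seam
  Point := F.Point ⊕ G.Point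
  VertP := F.VertP ⊕ G.VertP
  VertN := F.VertN ⊕ G.VertN
  genus := Sum.elim F.genus G.genus
  weight := Sum.elim F.weight G.weight
  weight_pos := by rintro (f | f); exacts [F.weight_pos f, G.weight_pos f]
  thin₁ := Sum.map F.thin₁ G.thin₁
  thin₂ := Sum.map F.thin₂ G.thin₂
  thick := Sum.map F.thick G.thick
  seam_weight := by rintro (f | f); exacts [F.seam_weight f, G.seam_weight f]
  side := Sum.map F.side G.side
  side_weight := by rintro (f | f); exacts [F.side_weight f, G.side_weight f]
  pointIn := Sum.map F.pointIn G.pointIn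
  pointOut := Sum.map F.pointOut G.pointOut
  aP := Sum.map F.aP G.aP
  bP := Sum.map F.bP G.bP
  cP := Sum.map F.cP G.cP
  dP := Sum.map F.dP G.dP
  aN := Sum.map F.aN G.aN
  bN := Sum.map F.bN G.bN
  cN := Sum.map F.cN G.cN
  dN := Sum.map F.dN G.dN
  atSplit := Sum.map F.atSplit G.atSplit
  atMerge := Sum.map F.atMerge G.atMerge
  target_bij := bij_sum F.target_bij G.target_bij
  source_bij := bij_sum F.source_bij G.source_bij
  point_match := by
    rintro (p | p)
    · simpa using F.point_match p
    · simpa using G.point_match p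
  vertP_match := by
    rintro (v | v)
    · exact vertexMatch_map (f₁ := F.thin₁) (f₂ := F.thin₂) (f₃ := F.thick) (j := Sum.inl)
        (k := Sum.inl) (fun _ => rfl) (fun _ => rfl) (fun _ => rfl) (F.vertP_match v)
    · exact vertexMatch_map (f₁ := G.thin₁) (f₂ := G.thin₂) (f₃ := G.thick) (j := Sum.inr)
        (k := Sum.inr) (fun _ => rfl) (fun _ => rfl) (fun _ => rfl) (G.vertP_match v)
  vertN_match := by
    rintro (v | v)
    · exact vertexMatch_map (f₁ := F.thin₁) (f₂ := F.thin₂) (f₃ := F.thick) (j := Sum.inl)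
        (k := Sum.inl) (fun _ => rfl) (fun _ => rfl) (fun _ => rfl) (F.vertN_match v)
    · exact vertexMatch_map (f₁ := G.thin₁) (f₂ := G.thin₂) (f₃ := G.thick) (j := Sum.inr)
        (k := Sum.inr) (fun _ => rfl) (fun _ => rfl) (fun _ => rfl) (G.vertN_match v)
  reg_match := by
    rintro (p | p)
    · exact congrArg Sum.inl (F.reg_match p)
    · exact congrArg Sum.inr (G.reg_match p)
  merge_match := by
    rintro (p | p)
    · have := F.merge_match p
      exact ⟨congrArg Sum.inl this.1, congrArg Sum.inl this.2.1, congrArg Sum.inl this.2.2⟩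
    · have := G.merge_match p
      exact ⟨congrArg Sum.inr this.1, congrArg Sum.inr this.2.1, congrArg Sum.inr this.2.2⟩
  split_match := by
    rintro (p | p)
    · have := F.split_match p
      exact ⟨congrArg Sum.inl this.1, congrArg Sum.inl this.2.1, congrArg Sum.inl this.2.2⟩
    · have := G.split_match p
      exact ⟨congrArg Sum.inr this.1, congrArg Sum.inr this.2.1, congrArg Sum.inr this.2.2⟩

/-- The facets of the product of a one-foam with an interval: its edges, up to bivalent points. -/
def cylRel (U : OneFoam) (e e' : U.Edge) : Prop := ∃ r, e = U.regIn r ∧ e' = U.regOut r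

/-- The product of a one-foam with an interval. -/
def cyl (U : OneFoam) : TwoFoam (U.reverse.union U) where
  Facet := Quot (cylRel U)
  Seam := U.Merge ⊕ U.Split
  Point := Empty
  VertP := Empty
  VertN := Empty
  genus := fun _ => 0
  weight := Quot.lift U.weight (by rintro _ _ ⟨r, rfl, rfl⟩; exact U.reg_weight r)
  weight_pos := by rintro ⟨e⟩; exact U.weight_pos e
  thin₁ := Sum.elim (fun m => Quot.mk _ (U.mergeIn₁ m)) (fun s => Quot.mk _ (U.splitOut₁ s))
  thin₂ := Sum.elim (fun m => Quot.mk _ (U.mergeIn₂ m)) (fun s => Quot.mk _ (U.splitOut₂ s))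
  thick := Sum.elim (fun m => Quot.mk _ (U.mergeOut m)) (fun s => Quot.mk _ (U.splitIn s))
  seam_weight := by rintro (m | s); exacts [U.merge_weight m, U.split_weight s]
  side := Sum.elim (Quot.mk _) (Quot.mk _)
  side_weight := by rintro (e | e) <;> rfl
  pointIn := Empty.elim
  pointOut := Empty.elim
  aP := Empty.elim
  bP := Empty.elim
  cP := Empty.elim
  dP := Empty.elim
  aN := Empty.elim
  bN := Empty.elim
  cN := Empty.elim
  dN := Empty.elim
  atSplit := id
  atMerge := Sum.swap
  target_bij := by
    refine ⟨?_, fun s => ⟨.inr (.inr (.inr (.inr (.inr s)))), rfl⟩⟩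
    rintro (x | x | x | x | x | x) (y | y | y | y | y | y) h <;>
      first | exact x.elim | exact y.elim | skip
    exact congrArg (fun z => Sum.inr (Sum.inr (Sum.inr (Sum.inr (Sum.inr z))))) h
  source_bij := by
    refine ⟨?_, fun s => ⟨.inr (.inr (.inr (.inr (.inr s.swap)))), Sum.swap_swap s⟩⟩
    rintro (x | x | x | x | x | x) (y | y | y | y | y | y) h <;>
      first | exact x.elim | exact y.elim | skip
    have h' : x = y := (Equiv.sumComm _ _).injective h
    rw [h']
  point_match := fun p => p.elim
  vertP_match := fun p => p.elim
  vertN_match := fun p => p.elim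
  reg_match := by
    rintro (r | r)
    · exact (Quot.sound ⟨r, rfl, rfl⟩).symm
    · exact Quot.sound ⟨r, rfl, rfl⟩
  merge_match := by rintro (m | m) <;> exact ⟨rfl, rfl, rfl⟩
  split_match := by rintro (m | m) <;> exact ⟨rfl, rfl, rfl⟩

/-- Facets of two cobordisms that meet along an edge of the one-foam between them. -/
inductive GlueRel {U V W : OneFoam} (F : TwoFoam (U.reverse.union V))
    (G : TwoFoam (V.reverse.union W)) : F.Facet ⊕ G.Facet → F.Facet ⊕ G.Facet → Prop
  | edge (e : V.Edge) : GlueRel F G (.inl (F.side (.inr e))) (.inr (G.side (.inl e)))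

theorem glue_bij {A B C D E G₁ G₂ A' B' C' D' E' G₁' G₂' S S' : Type} {a : A → S} {b : B → S}
    {c : C → S} {d : D → S} {e : E → S} {g : G₁ ⊕ G₂ → S} {a' : A' → S'} {b' : B' → S'}
    {c' : C' → S'} {d' : D' → S'} {e' : E' → S'} {g' : G₁' ⊕ G₂' → S'}
    (h : Function.Bijective (Sum.elim a (Sum.elim b (Sum.elim c (Sum.elim d (Sum.elim e g))))))
    (h' : Function.Bijective
      (Sum.elim a' (Sum.elim b' (Sum.elim c' (Sum.elim d' (Sum.elim e' g')))))) :
    Function.Bijective (Sum.elim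
      (Sum.elim (Sum.map a a') (Sum.elim (fun x => Sum.inl (g (.inr x)))
        (fun x => Sum.inr (g' (.inl x)))))
      (Sum.elim (Sum.map b b') (Sum.elim (Sum.map c c') (Sum.elim (Sum.map d d')
        (Sum.elim (Sum.map e e')
          (Sum.elim (fun x => Sum.inl (g (.inl x))) (fun x => Sum.inr (g' (.inr x))))))))) := by
  have hb := bij_sum h h'
  let k : ((A ⊕ A') ⊕ (G₂ ⊕ G₁')) ⊕ ((B ⊕ B') ⊕ ((C ⊕ C') ⊕ ((D ⊕ D') ⊕ ((E ⊕ E') ⊕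
      (G₁ ⊕ G₂'))))) ≃
      (A ⊕ A') ⊕ ((B ⊕ B') ⊕ ((C ⊕ C') ⊕ ((D ⊕ D') ⊕ ((E ⊕ E') ⊕
        ((G₁ ⊕ G₂) ⊕ (G₁' ⊕ G₂')))))) :=
    { toFun := fun x => match x with
        | .inl (.inl y) => .inl y
        | .inl (.inr (.inl y)) => .inr (.inr (.inr (.inr (.inr (.inl (.inr y))))))
        | .inl (.inr (.inr y)) => .inr (.inr (.inr (.inr (.inr (.inr (.inl y))))))
        | .inr (.inl y) => .inr (.inl y)
        | .inr (.inr (.inl y)) => .inr (.inr (.inl y))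
        | .inr (.inr (.inr (.inl y))) => .inr (.inr (.inr (.inl y)))
        | .inr (.inr (.inr (.inr (.inl y)))) => .inr (.inr (.inr (.inr (.inl y))))
        | .inr (.inr (.inr (.inr (.inr (.inl y))))) =>
            .inr (.inr (.inr (.inr (.inr (.inl (.inl y))))))
        | .inr (.inr (.inr (.inr (.inr (.inr y))))) =>
            .inr (.inr (.inr (.inr (.inr (.inr (.inr y))))))
      invFun := fun x => match x with
        | .inl y => .inl (.inl y)
        | .inr (.inr (.inr (.inr (.inr (.inl (.inr y)))))) => .inl (.inr (.inl y))
        | .inr (.inr (.inr (.inr (.inr (.inr (.inl y)))))) => .inl (.inr (.inr y))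
        | .inr (.inl y) => .inr (.inl y)
        | .inr (.inr (.inl y)) => .inr (.inr (.inl y))
        | .inr (.inr (.inr (.inl y))) => .inr (.inr (.inr (.inl y)))
        | .inr (.inr (.inr (.inr (.inl y)))) => .inr (.inr (.inr (.inr (.inl y))))
        | .inr (.inr (.inr (.inr (.inr (.inl (.inl y)))))) =>
            .inr (.inr (.inr (.inr (.inr (.inl y)))))
        | .inr (.inr (.inr (.inr (.inr (.inr (.inr y)))))) =>
            .inr (.inr (.inr (.inr (.inr (.inr y)))))
      left_inv := by
        rintro (((x | x) | (x | x)) | (x | x | x | x | x | x)) <;> rfl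
      right_inv := by
        rintro (x | x | x | x | x | (x | x) | (x | x)) <;> rfl }
  convert hb.comp k.bijective using 1
  funext x
  rcases x with ((x | x) | (x | x)) | (x | x) | (x | x) | (x | x) | (x | x) | (x | x) <;> rfl

/-- Glue two cobordisms along the one-foam between them. Facets that meet along an edge of `V` are
joined; the seams that end at a vertex of `V` are joined at a bivalent point. (Only the existence
of some two-foam is used, and the genus of the joined facets is set to `0`.) -/
def glue {U V W : OneFoam} (F : TwoFoam (U.reverse.union V)) (G : TwoFoam (V.reverse.union W)) :
    TwoFoam (U.reverse.union W) where
  Facet := Quot (GlueRel F G)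
  Seam := F.Seam ⊕ G.Seam
  Point := (F.Point ⊕ G.Point) ⊕ (V.Split ⊕ V.Merge)
  VertP := F.VertP ⊕ G.VertP
  VertN := F.VertN ⊕ G.VertN
  genus := fun _ => 0
  weight := Quot.lift (Sum.elim F.weight G.weight) (by
    rintro _ _ ⟨e⟩
    exact (F.side_weight (.inr e)).trans (G.side_weight (.inl e)).symm)
  weight_pos := by rintro ⟨f | f⟩; exacts [F.weight_pos f, G.weight_pos f]
  thin₁ := fun s => Quot.mk _ (Sum.map F.thin₁ G.thin₁ s)
  thin₂ := fun s => Quot.mk _ (Sum.map F.thin₂ G.thin₂ s)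
  thick := fun s => Quot.mk _ (Sum.map F.thick G.thick s)
  seam_weight := by rintro (f | f); exacts [F.seam_weight f, G.seam_weight f]
  side := Sum.elim (fun e => Quot.mk _ (.inl (F.side (.inl e))))
    (fun e => Quot.mk _ (.inr (G.side (.inr e))))
  side_weight := by rintro (f | f); exacts [F.side_weight (.inl f), G.side_weight (.inr f)]
  pointIn := Sum.elim (Sum.map F.pointIn G.pointIn)
    (Sum.elim (fun s => .inl (F.atSplit (.inr s))) (fun m => .inr (G.atSplit (.inl m))))
  pointOut := Sum.elim (Sum.map F.pointOut G.pointOut)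
    (Sum.elim (fun s => .inr (G.atMerge (.inl s))) (fun m => .inl (F.atMerge (.inr m))))
  aP := Sum.map F.aP G.aP
  bP := Sum.map F.bP G.bP
  cP := Sum.map F.cP G.cP
  dP := Sum.map F.dP G.dP
  aN := Sum.map F.aN G.aN
  bN := Sum.map F.bN G.bN
  cN := Sum.map F.cN G.cN
  dN := Sum.map F.dN G.dN
  atSplit := Sum.elim (fun s => .inl (F.atSplit (.inl s))) (fun s => .inr (G.atSplit (.inr s)))
  atMerge := Sum.elim (fun s => .inl (F.atMerge (.inl s))) (fun s => .inr (G.atMerge (.inr s)))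
  target_bij := glue_bij F.target_bij G.target_bij
  source_bij := by
    have := (glue_bij F.source_bij G.source_bij).comp
      (Equiv.sumCongr (Equiv.sumCongr (Equiv.refl _) (Equiv.sumComm _ _))
        (Equiv.refl _)).bijective
    refine Eq.mp (congrArg Function.Bijective ?_) this
    funext x
    rcases x with ((x | x) | (x | x)) | (x | x) | (x | x) | (x | x) | (x | x) | (x | x) <;> rfl
  point_match := by
    rintro ((p | p) | (s | m))
    · have := F.point_match p
      exact ⟨congrArg (fun f => Quot.mk (GlueRel F G) (Sum.inl f)) this.1,
        congrArg (fun f => Quot.mk (GlueRel F G) (Sum.inl f)) this.2.1,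
        congrArg (fun f => Quot.mk (GlueRel F G) (Sum.inl f)) this.2.2⟩
    · have := G.point_match p
      exact ⟨congrArg (fun f => Quot.mk (GlueRel F G) (Sum.inr f)) this.1,
        congrArg (fun f => Quot.mk (GlueRel F G) (Sum.inr f)) this.2.1,
        congrArg (fun f => Quot.mk (GlueRel F G) (Sum.inr f)) this.2.2⟩
    · have hF := F.split_match (.inr s)
      have hG := G.merge_match (.inl s)
      refine ⟨?_, ?_, ?_⟩
      · exact (congrArg (fun f => Quot.mk (GlueRel F G) (Sum.inl f)) hF.1.symm).trans
          ((Quot.sound (GlueRel.edge (V.splitOut₁ s))).trans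
            (congrArg (fun f => Quot.mk (GlueRel F G) (Sum.inr f)) hG.1))
      · exact (congrArg (fun f => Quot.mk (GlueRel F G) (Sum.inl f)) hF.2.1.symm).trans
          ((Quot.sound (GlueRel.edge (V.splitOut₂ s))).trans
            (congrArg (fun f => Quot.mk (GlueRel F G) (Sum.inr f)) hG.2.1))
      · exact (congrArg (fun f => Quot.mk (GlueRel F G) (Sum.inl f)) hF.2.2.symm).trans
          ((Quot.sound (GlueRel.edge (V.splitIn s))).trans
            (congrArg (fun f => Quot.mk (GlueRel F G) (Sum.inr f)) hG.2.2))
    · have hF := F.merge_match (.inr m)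
      have hG := G.split_match (.inl m)
      refine ⟨?_, ?_, ?_⟩
      · exact ((congrArg (fun f => Quot.mk (GlueRel F G) (Sum.inl f)) hF.1.symm).trans
          ((Quot.sound (GlueRel.edge (V.mergeIn₁ m))).trans
            (congrArg (fun f => Quot.mk (GlueRel F G) (Sum.inr f)) hG.1))).symm
      · exact ((congrArg (fun f => Quot.mk (GlueRel F G) (Sum.inl f)) hF.2.1.symm).trans
          ((Quot.sound (GlueRel.edge (V.mergeIn₂ m))).trans
            (congrArg (fun f => Quot.mk (GlueRel F G) (Sum.inr f)) hG.2.1))).symm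
      · exact ((congrArg (fun f => Quot.mk (GlueRel F G) (Sum.inl f)) hF.2.2.symm).trans
          ((Quot.sound (GlueRel.edge (V.mergeOut m))).trans
            (congrArg (fun f => Quot.mk (GlueRel F G) (Sum.inr f)) hG.2.2))).symm
  vertP_match := by
    rintro (v | v)
    · exact vertexMatch_map (f₁ := F.thin₁) (f₂ := F.thin₂) (f₃ := F.thick) (j := Sum.inl)
        (k := fun f => Quot.mk (GlueRel F G) (Sum.inl f)) (fun _ => rfl) (fun _ => rfl) (fun _ => rfl)
        (F.vertP_match v)
    · exact vertexMatch_map (f₁ := G.thin₁) (f₂ := G.thin₂) (f₃ := G.thick) (j := Sum.inr)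
        (k := fun f => Quot.mk (GlueRel F G) (Sum.inr f)) (fun _ => rfl) (fun _ => rfl) (fun _ => rfl)
        (G.vertP_match v)
  vertN_match := by
    rintro (v | v)
    · exact vertexMatch_map (f₁ := F.thin₁) (f₂ := F.thin₂) (f₃ := F.thick) (j := Sum.inl)
        (k := fun f => Quot.mk (GlueRel F G) (Sum.inl f)) (fun _ => rfl) (fun _ => rfl) (fun _ => rfl)
        (F.vertN_match v)
    · exact vertexMatch_map (f₁ := G.thin₁) (f₂ := G.thin₂) (f₃ := G.thick) (j := Sum.inr)
        (k := fun f => Quot.mk (GlueRel F G) (Sum.inr f)) (fun _ => rfl) (fun _ => rfl) (fun _ => rfl)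
        (G.vertN_match v)
  reg_match := by
    rintro (r | r)
    · exact congrArg (fun f => Quot.mk (GlueRel F G) (Sum.inl f)) (F.reg_match (.inl r))
    · exact congrArg (fun f => Quot.mk (GlueRel F G) (Sum.inr f)) (G.reg_match (.inr r))
  merge_match := by
    rintro (r | r)
    · have := F.merge_match (.inl r)
      exact ⟨congrArg (fun f => Quot.mk (GlueRel F G) (Sum.inl f)) this.1,
        congrArg (fun f => Quot.mk (GlueRel F G) (Sum.inl f)) this.2.1,
        congrArg (fun f => Quot.mk (GlueRel F G) (Sum.inl f)) this.2.2⟩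
    · have := G.merge_match (.inr r)
      exact ⟨congrArg (fun f => Quot.mk (GlueRel F G) (Sum.inr f)) this.1,
        congrArg (fun f => Quot.mk (GlueRel F G) (Sum.inr f)) this.2.1,
        congrArg (fun f => Quot.mk (GlueRel F G) (Sum.inr f)) this.2.2⟩
  split_match := by
    rintro (r | r)
    · have := F.split_match (.inl r)
      exact ⟨congrArg (fun f => Quot.mk (GlueRel F G) (Sum.inl f)) this.1,
        congrArg (fun f => Quot.mk (GlueRel F G) (Sum.inl f)) this.2.1,
        congrArg (fun f => Quot.mk (GlueRel F G) (Sum.inl f)) this.2.2⟩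
    · have := G.split_match (.inr r)
      exact ⟨congrArg (fun f => Quot.mk (GlueRel F G) (Sum.inr f)) this.1,
        congrArg (fun f => Quot.mk (GlueRel F G) (Sum.inr f)) this.2.1,
        congrArg (fun f => Quot.mk (GlueRel F G) (Sum.inr f)) this.2.2⟩

end TwoFoam

/-! ### The cobordism group of weighted oriented one-foams -/

namespace OneFoam

theorem cobordant_of_iso {U V : OneFoam} (i : U.Iso V) : Cobordant U V := by
  refine ⟨(TwoFoam.cyl U).transport
    ⟨(Equiv.refl _).sumCongr i.edge, (Equiv.refl _).sumCongr i.reg, (Equiv.refl _).sumCongr i.merge,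
      (Equiv.refl _).sumCongr i.split, ?_, ?_, ?_, ?_, ?_, ?_, ?_, ?_, ?_⟩⟩
  all_goals rintro (x | x)
  all_goals first | rfl | skip
  · exact i.weight x
  · exact congrArg Sum.inr (i.regIn x)
  · exact congrArg Sum.inr (i.regOut x)
  · exact congrArg Sum.inr (i.mergeIn₁ x)
  · exact congrArg Sum.inr (i.mergeIn₂ x)
  · exact congrArg Sum.inr (i.mergeOut x)
  · exact congrArg Sum.inr (i.splitIn x)
  · exact congrArg Sum.inr (i.splitOut₁ x)
  · exact congrArg Sum.inr (i.splitOut₂ x)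

theorem cobordant_symm {U V : OneFoam} : Cobordant U V → Cobordant V U := by
  rintro ⟨F⟩
  refine ⟨F.reverse.transport ⟨Equiv.sumComm _ _, Equiv.sumComm _ _, Equiv.sumComm _ _,
    Equiv.sumComm _ _, ?_, ?_, ?_, ?_, ?_, ?_, ?_, ?_, ?_⟩⟩
  all_goals rintro (x | x) <;> rfl

theorem cobordant_reverse {U V : OneFoam} :
    Cobordant U V → Cobordant U.reverse V.reverse := by
  rintro ⟨F⟩
  refine ⟨F.reverse.transport ⟨Equiv.refl _, Equiv.refl _, Equiv.refl _,
    Equiv.refl _, ?_, ?_, ?_, ?_, ?_, ?_, ?_, ?_, ?_⟩⟩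
  all_goals rintro (x | x) <;> rfl

theorem cobordant_union {U V U' V' : OneFoam} :
    Cobordant U V → Cobordant U' V' → Cobordant (U.union U') (V.union V') := by
  rintro ⟨F⟩ ⟨G⟩
  refine ⟨(F.union G).transport ⟨Equiv.sumSumSumComm _ _ _ _, Equiv.sumSumSumComm _ _ _ _,
    Equiv.sumSumSumComm _ _ _ _, Equiv.sumSumSumComm _ _ _ _, ?_, ?_, ?_, ?_, ?_, ?_, ?_, ?_, ?_⟩⟩
  all_goals rintro ((x | x) | (x | x)) <;> rfl

theorem cobordant_comm (U V : OneFoam) : Cobordant (U.union V) (V.union U) := by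
  refine cobordant_of_iso ⟨Equiv.sumComm _ _, Equiv.sumComm _ _, Equiv.sumComm _ _,
    Equiv.sumComm _ _, ?_, ?_, ?_, ?_, ?_, ?_, ?_, ?_, ?_⟩
  all_goals rintro (x | x) <;> rfl

theorem cobordant_assoc (U V W : OneFoam) :
    Cobordant ((U.union V).union W) (U.union (V.union W)) := by
  refine cobordant_of_iso ⟨Equiv.sumAssoc _ _ _, Equiv.sumAssoc _ _ _, Equiv.sumAssoc _ _ _,
    Equiv.sumAssoc _ _ _, ?_, ?_, ?_, ?_, ?_, ?_, ?_, ?_, ?_⟩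
  all_goals rintro ((x | x) | x) <;> rfl

/-- A one-foam does not change when the empty one-foam is added. -/
def unionEmpty (U : OneFoam) : (U.union empty).Iso U where
  edge := Equiv.sumEmpty _ Empty
  reg := Equiv.sumEmpty _ Empty
  merge := Equiv.sumEmpty _ Empty
  split := Equiv.sumEmpty _ Empty
  weight := by rintro (x | x); exacts [rfl, x.elim]
  regIn := by rintro (x | x); exacts [rfl, x.elim]
  regOut := by rintro (x | x); exacts [rfl, x.elim]
  mergeIn₁ := by rintro (x | x); exacts [rfl, x.elim]
  mergeIn₂ := by rintro (x | x); exacts [rfl, x.elim]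
  mergeOut := by rintro (x | x); exacts [rfl, x.elim]
  splitIn := by rintro (x | x); exacts [rfl, x.elim]
  splitOut₁ := by rintro (x | x); exacts [rfl, x.elim]
  splitOut₂ := by rintro (x | x); exacts [rfl, x.elim]

theorem cobordant_reverse_union (U : OneFoam) : Cobordant (U.reverse.union U) empty := by
  refine ⟨(TwoFoam.cyl U).reverse.transport ⟨(Equiv.sumEmpty _ Empty).symm,
    (Equiv.sumEmpty _ Empty).symm, (Equiv.sumEmpty _ Empty).symm, (Equiv.sumEmpty _ Empty).symm,
    ?_, ?_, ?_, ?_, ?_, ?_, ?_, ?_, ?_⟩⟩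
  all_goals intro x; rfl

/-- Cobordance is an equivalence relation. -/
instance cobSetoid : Setoid OneFoam where
  r := Cobordant
  iseqv :=
    { refl := fun U => ⟨TwoFoam.cyl U⟩
      symm := cobordant_symm
      trans := fun ⟨F⟩ ⟨G⟩ => ⟨F.glue G⟩ }

end OneFoam

/-- The cobordism group of weighted oriented one-foams. -/
def Cob : Type 1 := Quotient OneFoam.cobSetoid

namespace Cob

/-- The cobordism class of a one-foam. -/
def mk (U : OneFoam) : Cob := Quotient.mk _ U

/-- The zero element is the class of the empty one-foam. -/
instance : Zero Cob := ⟨mk OneFoam.empty⟩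

/-- Addition is disjoint union. -/
instance : Add Cob :=
  ⟨Quotient.map₂ OneFoam.union fun _ _ h _ _ h' => OneFoam.cobordant_union h h'⟩

/-- The inverse is orientation reversal. -/
instance : Neg Cob :=
  ⟨Quotient.map OneFoam.reverse fun _ _ h => OneFoam.cobordant_reverse h⟩

instance : AddCommGroup Cob where
  add_assoc := by
    rintro ⟨U⟩ ⟨V⟩ ⟨W⟩
    exact Quotient.sound (OneFoam.cobordant_assoc U V W)
  add_comm := by
    rintro ⟨U⟩ ⟨V⟩
    exact Quotient.sound (OneFoam.cobordant_comm U V)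
  add_zero := by
    rintro ⟨U⟩
    exact Quotient.sound (OneFoam.cobordant_of_iso U.unionEmpty)
  zero_add := by
    rintro ⟨U⟩
    exact (Quotient.sound (OneFoam.cobordant_comm _ U)).trans
      (Quotient.sound (OneFoam.cobordant_of_iso U.unionEmpty))
  neg_add_cancel := by
    rintro ⟨U⟩
    exact Quotient.sound (OneFoam.cobordant_reverse_union U)
  nsmul := nsmulRec
  zsmul := zsmulRec

/-- A one-foam represents zero if and only if it bounds a two-foam. -/
theorem mk_eq_zero_iff (U : OneFoam) : mk U = 0 ↔ Nonempty (TwoFoam U) := by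
  have key : ∀ V : OneFoam, Nonempty (TwoFoam V.reverse) → mk V = 0 := fun V ⟨F⟩ =>
    Quotient.sound ⟨F.transport ⟨(Equiv.sumEmpty _ Empty).symm, (Equiv.sumEmpty _ Empty).symm,
      (Equiv.sumEmpty _ Empty).symm, (Equiv.sumEmpty _ Empty).symm, fun _ => rfl, fun _ => rfl,
      fun _ => rfl, fun _ => rfl, fun _ => rfl, fun _ => rfl, fun _ => rfl, fun _ => rfl,
      fun _ => rfl⟩⟩
  refine ⟨fun h => ?_, fun ⟨F⟩ => key U ⟨F.reverse⟩⟩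
  obtain ⟨F⟩ : Cobordant U OneFoam.empty := Quotient.exact h
  exact ⟨(F.transport (OneFoam.unionEmpty U.reverse)).reverse⟩

end Cob

/-! ### Interval exchange transformations -/

/-- The data `(λ, σ)` of an interval exchange transformation of `[0,1)`: positive lengths of `r`
intervals with sum `1` (hence `r ≥ 1`), and a permutation. -/
structure IETData where
  r : ℕ
  len : Fin r → ℝ
  len_pos : ∀ i, 0 < len i
  len_sum : ∑ i, len i = 1
  perm : Equiv.Perm (Fin r)

namespace IETData

variable (D : IETData)

/-- The left end of the `i`-th interval when the intervals are put in the order that `τ`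
prescribes, that is, when the `j`-th interval is `τ j`-th in the order. -/
noncomputable def left (τ : Equiv.Perm (Fin D.r)) (i : Fin D.r) : ℝ :=
  ∑ j with τ j < τ i, D.len j

theorem left_nonneg (τ : Equiv.Perm (Fin D.r)) (i : Fin D.r) : 0 ≤ D.left τ i :=
  Finset.sum_nonneg fun j _ => (D.len_pos j).le

theorem left_add_len (τ : Equiv.Perm (Fin D.r)) (i : Fin D.r) :
    D.left τ i + D.len i = ∑ j with τ j ≤ τ i, D.len j := by
  classical
  have : (Finset.univ.filter fun j => τ j ≤ τ i) =
      insert i (Finset.univ.filter fun j => τ j < τ i) := by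
    ext j
    simp only [Finset.mem_filter, Finset.mem_univ, true_and, Finset.mem_insert, le_iff_lt_or_eq,
      τ.injective.eq_iff]
    tauto
  rw [this, Finset.sum_insert (by simp), left, add_comm]

theorem left_add_len_le_one (τ : Equiv.Perm (Fin D.r)) (i : Fin D.r) :
    D.left τ i + D.len i ≤ 1 := by
  rw [left_add_len, ← D.len_sum]
  exact Finset.sum_le_sum_of_subset_of_nonneg (Finset.subset_univ _)
    fun j _ _ => (D.len_pos j).le

theorem left_add_len_le_left (τ : Equiv.Perm (Fin D.r)) {i j : Fin D.r} (h : τ i < τ j) :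
    D.left τ i + D.len i ≤ D.left τ j := by
  rw [left_add_len]
  refine Finset.sum_le_sum_of_subset_of_nonneg (fun k hk => ?_) fun j _ _ => (D.len_pos j).le
  simp only [Finset.mem_filter, Finset.mem_univ, true_and] at hk ⊢
  exact hk.trans_lt h

/-- Put the intervals `[0, λ_i)` side by side in the order that `τ` prescribes. -/
noncomputable def place (τ : Equiv.Perm (Fin D.r)) (p : Σ i : Fin D.r, Set.Ico (0 : ℝ) (D.len i)) :
    Set.Ico (0 : ℝ) 1 :=
  ⟨D.left τ p.1 + p.2, add_nonneg (D.left_nonneg τ p.1) p.2.2.1,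
    (add_lt_add_right p.2.2.2 _).trans_le (D.left_add_len_le_one τ p.1)⟩

theorem place_bijective (τ : Equiv.Perm (Fin D.r)) : Function.Bijective (D.place τ) := by
  constructor
  · rintro ⟨i, x⟩ ⟨j, y⟩ h
    have h' : D.left τ i + x = D.left τ j + y := congrArg Subtype.val h
    rcases lt_trichotomy (τ i) (τ j) with hij | hij | hij
    · have := D.left_add_len_le_left τ hij
      have := x.2.2
      have := y.2.1
      linarith
    · obtain rfl := τ.injective hij
      have : x = y := Subtype.ext (by linarith)
      rw [this]
    · have := D.left_add_len_le_left τ hij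
      have := y.2.2
      have := x.2.1
      linarith
  · rintro ⟨y, hy0, hy1⟩
    have hr : 0 < D.r := by
      rcases Nat.eq_zero_or_pos D.r with h | h
      · have := D.len_sum
        have : IsEmpty (Fin D.r) := by rw [h]; infer_instance
        simp_all
      · exact h
    have hne : (Finset.univ.filter fun i => D.left τ i ≤ y).Nonempty := by
      refine ⟨τ.symm ⟨0, hr⟩, ?_⟩
      simp only [Finset.mem_filter, Finset.mem_univ, true_and]
      refine le_trans (le_of_eq ?_) hy0
      refine Finset.sum_eq_zero fun j hj => ?_
      simp [Fin.lt_def] at hj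
    obtain ⟨i, hi, hmax⟩ := Finset.exists_max_image _ τ hne
    simp only [Finset.mem_filter, Finset.mem_univ, true_and] at hi hmax
    have hlt : y < D.left τ i + D.len i := by
      by_contra! hge
      have hlast : ∀ j, τ j ≤ τ i := by
        by_contra! hex
        obtain ⟨j, hj⟩ := hex
        have hk : (τ i : ℕ) + 1 < D.r := lt_of_le_of_lt (Fin.lt_def.1 hj) (τ j).2
        have hle : D.left τ (τ.symm ⟨τ i + 1, hk⟩) ≤ y := by
          refine le_trans (le_of_eq ?_) hge
          rw [left_add_len, left]
          refine Finset.sum_congr ?_ fun _ _ => rfl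
          ext k
          simp only [Finset.mem_filter, Finset.mem_univ, true_and, Equiv.apply_symm_apply,
            Fin.lt_def, Fin.le_def]
          omega
        have := hmax _ hle
        simp [Fin.le_def] at this
      rw [left_add_len, Finset.filter_true_of_mem fun j _ => hlast j, D.len_sum] at hge
      linarith
    exact ⟨⟨i, ⟨y - D.left τ i, by linarith, by linarith⟩⟩, Subtype.ext (by simp [place])⟩

/-- The interval exchange transformation `T_{λ,σ}`: cut `[0,1)` into consecutive intervals of
lengths `λ_1, …, λ_r`, and put the `i`-th of them into the `σ(i)`-th place. -/
noncomputable def map : Equiv.Perm (Set.Ico (0 : ℝ) 1) :=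
  (Equiv.ofBijective _ (D.place_bijective 1)).symm.trans
    (Equiv.ofBijective _ (D.place_bijective D.perm))

theorem map_place (p : Σ i : Fin D.r, Set.Ico (0 : ℝ) (D.len i)) :
    D.map (D.place 1 p) = D.place D.perm p := by
  have : (Equiv.ofBijective _ (D.place_bijective 1)).symm (D.place 1 p) = p :=
    (Equiv.ofBijective _ (D.place_bijective 1)).symm_apply_apply p
  rw [map, Equiv.trans_apply, this]
  rfl

/-- A helper notion: a self-map of `[0,1)` which is a translation on every interval that contains
none of finitely many break points, except possibly as its left end. -/
def IsPiecewise (f : Set.Ico (0 : ℝ) 1 → Set.Ico (0 : ℝ) 1) : Prop :=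
  ∃ B : Finset ℝ, ∀ x y : Set.Ico (0 : ℝ) 1, x ≤ y → (∀ b ∈ B, ¬ ((x : ℝ) < b ∧ b ≤ y)) →
    (f y : ℝ) - f x = y - x

theorem isPiecewise_comp {f g : Set.Ico (0 : ℝ) 1 → Set.Ico (0 : ℝ) 1} (hf : IsPiecewise f)
    (hg : IsPiecewise g) (hinj : Function.Injective f) : IsPiecewise (g ∘ f) := by
  classical
  obtain ⟨B, hB⟩ := hf
  obtain ⟨C, hC⟩ := hg
  let C' : Set (Set.Ico (0 : ℝ) 1) := {z | (f z : ℝ) ∈ C}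
  have hC' : C'.Finite :=
    Set.Finite.preimage (f := fun z => (f z : ℝ))
      (Subtype.val_injective.comp hinj).injOn C.finite_toSet
  refine ⟨B ∪ hC'.toFinset.image Subtype.val, fun x y hxy h => ?_⟩
  have h1 := hB x y hxy fun b hb => h b (Finset.mem_union_left _ hb)
  have hxy' : (x : ℝ) ≤ y := hxy
  have h2 := hC (f x) (f y) (by
    change (f x : ℝ) ≤ f y
    linarith) fun c hc hcxy => by
      let z : Set.Ico (0 : ℝ) 1 := ⟨x + (c - f x), by linarith [x.2.1], by linarith [y.2.2]⟩
      have hz := hB x z (by change (x : ℝ) ≤ x + (c - f x); linarith) fun b hb hbz =>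
        h b (Finset.mem_union_left _ hb) ⟨hbz.1, hbz.2.trans (by
          change (x : ℝ) + (c - f x) ≤ y; linarith)⟩
      have hzc : (f z : ℝ) = c := by
        have : (z : ℝ) = x + (c - f x) := rfl
        linarith
      refine h z (Finset.mem_union_right _ (Finset.mem_image_of_mem _ ?_)) ⟨?_, ?_⟩
      · rw [Set.Finite.mem_toFinset]
        change (f z : ℝ) ∈ C
        rwa [hzc]
      · change (x : ℝ) < x + (c - f x); linarith
      · change (x : ℝ) + (c - f x) ≤ y; linarith
  simp only [Function.comp]
  linarith

theorem isPiecewise_of_place {τ τ' : Equiv.Perm (Fin D.r)}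
    {f : Set.Ico (0 : ℝ) 1 → Set.Ico (0 : ℝ) 1} (hf : ∀ p, f (D.place τ p) = D.place τ' p) :
    IsPiecewise f := by
  classical
  refine ⟨Finset.univ.image (D.left τ), fun x y hxy h => ?_⟩
  obtain ⟨⟨i, a⟩, rfl⟩ := (D.place_bijective τ).2 x
  obtain ⟨⟨j, b⟩, rfl⟩ := (D.place_bijective τ).2 y
  have hxy' : D.left τ i + a ≤ D.left τ j + b := hxy
  have ha := a.2
  have hb := b.2
  have hj := h (D.left τ j) (Finset.mem_image_of_mem _ (Finset.mem_univ _))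
  simp only [place, not_and, not_le] at hj
  have hij : i = j := by
    rcases lt_trichotomy (τ i) (τ j) with hij | hij | hij
    · have := D.left_add_len_le_left τ hij
      have := hj (by linarith [ha.2])
      linarith [hb.1]
    · exact τ.injective hij
    · have := D.left_add_len_le_left τ hij
      linarith [ha.1, hb.2]
  subst hij
  rw [hf, hf]
  simp [place]

theorem sum_len_le {ι : Type} [DecidableEq ι] (len q : ι → ℝ) (hlen : ∀ i, 0 < len i)
    (hdis : ∀ i j, i ≠ j → q i + len i ≤ q j ∨ q j + len j ≤ q i) (a : ℝ) (S : Finset ι) :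
    ∀ b : ℝ, a ≤ b → (∀ i ∈ S, a ≤ q i ∧ q i + len i ≤ b) → ∑ i ∈ S, len i ≤ b - a := by
  induction S using Finset.induction_on_max_value q with
  | empty => intro b hab _; simpa using hab
  | insert m S hm hmax ih =>
    intro b _ h
    rw [Finset.sum_insert hm]
    have h1 := h m (Finset.mem_insert_self _ _)
    have h2 := ih (q m) h1.1 fun i hi => ⟨(h i (Finset.mem_insert_of_mem hi)).1, by
      have hne : i ≠ m := by rintro rfl; exact hm hi
      rcases hdis i m hne with h3 | h3
      · exact h3
      · have := hmax i hi
        linarith [hlen m]⟩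
    linarith

theorem eq_sum_len {r : ℕ} (len q : Fin r → ℝ) (hlen : ∀ i, 0 < len i) (hsum : ∑ i, len i = 1)
    (hdis : ∀ i j, i ≠ j → q i + len i ≤ q j ∨ q j + len j ≤ q i) (h0 : ∀ i, 0 ≤ q i)
    (h1 : ∀ i, q i + len i ≤ 1) (i : Fin r) : ∑ j with q j < q i, len j = q i := by
  have hinj : ∀ j k, q j = q k → j = k := by
    intro j k h
    by_contra hne
    have := hlen j
    have := hlen k
    rcases hdis j k hne with h | h <;> linarith
  have hle := sum_len_le len q hlen hdis 0 (Finset.univ.filter fun j => q j < q i) (q i) (h0 i)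
    fun j hj => ⟨h0 j, by
      have hlt : q j < q i := by simpa using hj
      rcases hdis j i (by rintro rfl; exact lt_irrefl _ hlt) with h | h
      · exact h
      · linarith [hlen i]⟩
  have hge := sum_len_le len q hlen hdis (q i) (Finset.univ.filter fun j => ¬ q j < q i) 1
    (by linarith [h1 i, hlen i]) fun j hj => ⟨by simpa using hj, h1 j⟩
  have := Finset.sum_filter_add_sum_filter_not Finset.univ (fun j => q j < q i) len
  linarith

theorem exists_map_eq (f : Equiv.Perm (Set.Ico (0 : ℝ) 1)) (hf : IsPiecewise f) :
    ∃ D : IETData, D.map = f := by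
  classical
  obtain ⟨B, hB⟩ := hf
  let B' : Finset ℝ := insert 0 (B.filter fun b => 0 < b ∧ b < 1)
  have hB'0 : ∀ b ∈ B', 0 ≤ b ∧ b < 1 := by
    intro b hb
    rcases Finset.mem_insert.1 hb with rfl | hb
    · norm_num
    · have := (Finset.mem_filter.1 hb).2
      exact ⟨this.1.le, this.2⟩
  obtain ⟨r, hr⟩ : ∃ r, B'.card = r := ⟨_, rfl⟩
  let p := B'.orderEmbOfFin hr
  have hp : ∀ i, 0 ≤ p i ∧ p i < 1 := fun i => hB'0 _ (B'.orderEmbOfFin_mem hr i)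
  have hr0 : 0 < r := by
    rw [← hr]
    exact Finset.card_pos.2 ⟨0, Finset.mem_insert_self _ _⟩
  let P : ℕ → ℝ := fun k => if h : k < r then p ⟨k, h⟩ else 1
  have hP : ∀ i : Fin r, P i = p i := fun i => by simp [P]
  have hPr : ∀ k, r ≤ k → P k = 1 := fun k hk => by simp [P, hk]
  have hPmono : ∀ (i : Fin r) (k : ℕ), (i : ℕ) < k → p i < P k := by
    intro i k hk
    by_cases h : k < r
    · have : p i < p ⟨k, h⟩ := p.lt_iff_lt.2 hk
      simpa [P, h] using this
    · rw [hPr k (by omega)]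
      exact (hp i).2
  have hPle : ∀ (i : Fin r) (k : ℕ), k ≤ (i : ℕ) → P k ≤ p i := by
    intro i k hk
    have h : k < r := lt_of_le_of_lt hk i.2
    have : p ⟨k, h⟩ ≤ p i := p.le_iff_le.2 hk
    simpa [P, h] using this
  have hP0 : P 0 = 0 := by
    refine le_antisymm ?_ ?_
    · have : (0 : ℝ) ∈ Set.range p := by
        rw [Finset.range_orderEmbOfFin]
        exact Finset.mem_insert_self _ _
      obtain ⟨i, hi⟩ := this
      exact (hPle i 0 (Nat.zero_le _)).trans_eq hi
    · have := (hp ⟨0, hr0⟩).1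
      rwa [← hP] at this
  let len : Fin r → ℝ := fun i => P (i + 1) - p i
  have hlen : ∀ i, 0 < len i := fun i => sub_pos.2 (hPmono i _ (Nat.lt_succ_self _))
  have hsum : ∑ i, len i = 1 := by
    have h1 : ∑ i, len i = ∑ i : Fin r, (fun k => P (k + 1) - P k) i :=
      Finset.sum_congr rfl fun i _ => by simp only [len, hP]
    rw [h1, Fin.sum_univ_eq_sum_range (fun k => P (k + 1) - P k), Finset.sum_range_sub, hP0,
      hPr r le_rfl, sub_zero]
  have hple1 : ∀ i, p i + len i ≤ 1 := by
    intro i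
    simp only [len, add_sub_cancel]
    by_cases h : (i : ℕ) + 1 < r
    · have := (hp ⟨i + 1, h⟩).2.le
      simpa [P, h] using this
    · rw [hPr _ (by omega)]
  have hpdis : ∀ i j, i < j → p i + len i ≤ p j := by
    intro i j hij
    simp only [len, add_sub_cancel]
    exact hPle j _ hij
  -- on each interval the map is a translation
  let P' : Fin r → Set.Ico (0 : ℝ) 1 := fun i => ⟨p i, (hp i).1, (hp i).2⟩
  let q : Fin r → ℝ := fun i => f (P' i)
  have htr : ∀ (i : Fin r) (x : Set.Ico (0 : ℝ) 1), p i ≤ x → (x : ℝ) < p i + len i →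
      (f x : ℝ) = q i + (x - p i) := by
    intro i x hx hx'
    have := hB (P' i) x hx fun b hb hbx => by
      have hbx1 : p i < b := hbx.1
      have hb' : b ∈ B' := Finset.mem_insert_of_mem (Finset.mem_filter.2
        ⟨hb, lt_of_le_of_lt (hp i).1 hbx1, lt_of_le_of_lt hbx.2 x.2.2⟩)
      have : b ∈ Set.range p := by
        rw [Finset.range_orderEmbOfFin]
        exact hb'
      obtain ⟨j, rfl⟩ := this
      have := hpdis i j (p.lt_iff_lt.1 hbx1)
      linarith [hbx.2]
    have h2 : ((P' i : Set.Ico (0 : ℝ) 1) : ℝ) = p i := rfl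
    change (f x : ℝ) = f (P' i) + (x - p i)
    linarith
  have hq0 : ∀ i, 0 ≤ q i := fun i => (f (P' i)).2.1
  have hq1 : ∀ i, q i + len i ≤ 1 := by
    intro i
    by_contra! h
    have hq : q i < 1 := (f (P' i)).2.2
    let x : Set.Ico (0 : ℝ) 1 := ⟨p i + (1 - q i), by linarith [(hp i).1], by linarith [hple1 i]⟩
    have h1 := htr i x (by change p i ≤ p i + (1 - q i); linarith)
      (by change p i + (1 - q i) < _; linarith)
    have h2 : (x : ℝ) = p i + (1 - q i) := rfl
    linarith [(f x).2.2]
  have hqdis' : ∀ i j, i ≠ j → q i ≤ q j → q i + len i ≤ q j := by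
    intro i j hij hq
    by_contra! h
    let x : Set.Ico (0 : ℝ) 1 := ⟨p i + (q j - q i), by linarith [(hp i).1], by
      linarith [hple1 i]⟩
    have hx : (x : ℝ) = p i + (q j - q i) := rfl
    have h1 := htr i x (by linarith) (by linarith)
    have h2 : f x = f (P' j) := Subtype.ext (by
      change (f x : ℝ) = q j
      linarith)
    have h3 : (x : ℝ) = p j := congrArg Subtype.val (f.injective h2)
    rcases lt_or_gt_of_ne hij with hij | hij
    · have := hpdis i j hij
      linarith
    · have := hpdis j i hij
      have := hlen j
      linarith
  have hqdis : ∀ i j, i ≠ j → q i + len i ≤ q j ∨ q j + len j ≤ q i := by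
    intro i j hij
    rcases le_total (q i) (q j) with h | h
    · exact Or.inl (hqdis' i j hij h)
    · exact Or.inr (hqdis' j i hij.symm h)
  have hqinj : Function.Injective q := fun i j h => by
    have h1 : P' i = P' j := f.injective (Subtype.ext h)
    have h2 : ((P' i : Set.Ico (0 : ℝ) 1) : ℝ) = P' j := by rw [h1]
    exact p.injective h2
  let σ : Equiv.Perm (Fin r) := (Tuple.sort q).symm
  have hmono : StrictMono (q ∘ Tuple.sort q) :=
    (Tuple.monotone_sort q).strictMono_of_injective (hqinj.comp (Tuple.sort q).injective)
  have hσ : ∀ i j, σ i < σ j ↔ q i < q j := by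
    intro i j
    rw [← hmono.lt_iff_lt]
    simp [σ]
  refine ⟨⟨r, len, hlen, hsum, σ⟩, ?_⟩
  set D : IETData := ⟨r, len, hlen, hsum, σ⟩ with hD
  have hleft1 : ∀ i : Fin r, D.left 1 i = p i := by
    intro i
    rw [← eq_sum_len len p hlen hsum (fun i j hij => (lt_or_gt_of_ne hij).imp (hpdis i j)
      (hpdis j i)) (fun i => (hp i).1) hple1 i]
    refine Finset.sum_congr (Finset.filter_congr fun j _ => ?_) fun _ _ => rfl
    exact p.lt_iff_lt.symm
  have hleftσ : ∀ i : Fin r, D.left σ i = q i := by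
    intro i
    rw [← eq_sum_len len q hlen hsum hqdis hq0 hq1 i]
    exact Finset.sum_congr (Finset.filter_congr fun j _ => hσ j i) fun _ _ => rfl
  ext y
  obtain ⟨⟨i, x⟩, rfl⟩ := (D.place_bijective 1).2 y
  have hv : ((D.place 1 ⟨i, x⟩ : Set.Ico (0 : ℝ) 1) : ℝ) = p i + x := by
    rw [← hleft1 i]
    rfl
  have hx0 : (0 : ℝ) ≤ x := x.2.1
  have hx1 : (x : ℝ) < len i := x.2.2
  rw [map_place, htr i (D.place 1 ⟨i, x⟩) (by linarith) (by linarith), hv, ← hleftσ i]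
  change D.left σ i + x = _
  ring

end IETData

/-- The group of interval exchange transformations of `[0,1)`: the bijections `T_{λ,σ}` with the
composition of maps, `(f * g) x = f (g x)`. -/
noncomputable def AutIET : Subgroup (Equiv.Perm (Set.Ico (0 : ℝ) 1)) where
  carrier := Set.range IETData.map
  mul_mem' := by
    rintro _ _ ⟨D, rfl⟩ ⟨E, rfl⟩
    have hE := E.isPiecewise_of_place (τ := 1) (τ' := E.perm) (f := E.map) E.map_place
    have hD := D.isPiecewise_of_place (τ := 1) (τ' := D.perm) (f := D.map) D.map_place
    exact IETData.exists_map_eq (D.map * E.map) (IETData.isPiecewise_comp (f := E.map)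
      (g := D.map) hE hD E.map.injective)
  one_mem' := IETData.exists_map_eq 1 ⟨∅, fun _ _ _ _ => rfl⟩
  inv_mem' := by
    rintro _ ⟨D, rfl⟩
    refine IETData.exists_map_eq D.map⁻¹
      (D.isPiecewise_of_place (τ := D.perm) (τ' := 1) (f := ⇑D.map⁻¹) fun p => ?_)
    rw [← D.map_place]
    exact D.map.symm_apply_apply _

/-- The interval exchange transformation `T_{λ,σ}` as an element of the group. -/
noncomputable def IETData.toAut (D : IETData) : AutIET := ⟨D.map, D, rfl⟩

/-! ### The closed one-foam of an interval exchange transformation -/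

/-- Plane binary trees with `n` leaves, numbered from left to right: the ways to split a line into
`n` lines (or to merge `n` lines into one) in a sequence of binary splits (merges). -/
inductive PlaneTree : ℕ → Type
  | leaf : PlaneTree 1
  | node {m n : ℕ} (s : PlaneTree m) (t : PlaneTree n) : PlaneTree (m + n)

namespace PlaneTree

/-- The inner vertices of a tree: none for `leaf`; for `node s t` they are the root `none`, the
inner vertices `some (inl p)` of `s` and the inner vertices `some (inr p)` of `t`. -/
@[reducible] def Inner {n : ℕ} (t : PlaneTree n) : Type :=
  PlaneTree.rec Empty (fun _ _ A B => Option (A ⊕ B)) t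

/-- The root of a tree, which is a leaf or an inner vertex. -/
def root : {n : ℕ} → (t : PlaneTree n) → Fin n ⊕ t.Inner
  | _, leaf => .inl 0
  | _, node _ _ => .inr none

/-- The leaves and inner vertices of the left subtree `s` of `node s t`. -/
def inLeft {m n : ℕ} (s : PlaneTree m) (t : PlaneTree n) :
    Fin m ⊕ s.Inner → Fin (m + n) ⊕ (node s t).Inner :=
  Sum.map (Fin.castAdd n) (fun p => some (.inl p))

/-- The leaves and inner vertices of the right subtree `t` of `node s t`. -/
def inRight {m n : ℕ} (s : PlaneTree m) (t : PlaneTree n) :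
    Fin n ⊕ t.Inner → Fin (m + n) ⊕ (node s t).Inner :=
  Sum.map (Fin.natAdd m) (fun p => some (.inr p))

/-- The left child of an inner vertex. -/
def child₁ : {n : ℕ} → (t : PlaneTree n) → t.Inner → Fin n ⊕ t.Inner
  | _, leaf, p => p.elim
  | _, node s t, none => inLeft s t s.root
  | _, node s t, some (.inl p) => inLeft s t (s.child₁ p)
  | _, node s t, some (.inr p) => inRight s t (t.child₁ p)

/-- The right child of an inner vertex. -/
def child₂ : {n : ℕ} → (t : PlaneTree n) → t.Inner → Fin n ⊕ t.Inner
  | _, leaf, p => p.elim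
  | _, node s t, none => inRight s t t.root
  | _, node s t, some (.inl p) => inLeft s t (s.child₂ p)
  | _, node s t, some (.inr p) => inRight s t (t.child₂ p)

/-- The total weight of the leaves below an inner vertex. -/
noncomputable def innerWeight : {n : ℕ} → (t : PlaneTree n) → (Fin n → ℝ) → t.Inner → ℝ
  | _, leaf, _, p => p.elim
  | _, node _ _, w, none => ∑ i, w i
  | _, node (n := n) s _, w, some (.inl p) => s.innerWeight (fun i => w (Fin.castAdd n i)) p
  | _, node (m := m) _ t, w, some (.inr p) => t.innerWeight (fun i => w (Fin.natAdd m i)) p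

/-- The total weight of the leaves below a leaf or an inner vertex. -/
noncomputable def weight {n : ℕ} (t : PlaneTree n) (w : Fin n → ℝ) : Fin n ⊕ t.Inner → ℝ :=
  Sum.elim w (t.innerWeight w)

instance finite_inner : {n : ℕ} → (t : PlaneTree n) → Finite t.Inner
  | _, leaf => inferInstanceAs (Finite Empty)
  | _, node s t =>
    have := s.finite_inner
    have := t.finite_inner
    inferInstanceAs (Finite (Option (s.Inner ⊕ t.Inner)))

theorem weight_inLeft {m n : ℕ} (s : PlaneTree m) (t : PlaneTree n) (w : Fin (m + n) → ℝ) (x) :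
    (node s t).weight w (inLeft s t x) = s.weight (fun i => w (Fin.castAdd n i)) x := by
  rcases x with x | x <;> rfl

theorem weight_inRight {m n : ℕ} (s : PlaneTree m) (t : PlaneTree n) (w : Fin (m + n) → ℝ) (x) :
    (node s t).weight w (inRight s t x) = t.weight (fun i => w (Fin.natAdd m i)) x := by
  rcases x with x | x <;> rfl

theorem weight_root {n : ℕ} (t : PlaneTree n) (w : Fin n → ℝ) : t.weight w t.root = ∑ i, w i := by
  cases t with
  | leaf => simp [weight, root]
  | node s t => rfl

theorem weight_child {n : ℕ} (t : PlaneTree n) (w : Fin n → ℝ) (p : t.Inner) :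
    t.weight w (t.child₁ p) + t.weight w (t.child₂ p) = t.weight w (.inr p) := by
  induction t with
  | leaf => exact p.elim
  | node s t hs ht =>
    rcases p with _ | p | p
    · change (node s t).weight w (inLeft s t s.root) + (node s t).weight w (inRight s t t.root) =
        ∑ i, w i
      rw [weight_inLeft, weight_inRight, weight_root, weight_root, Fin.sum_univ_add]
    · change (node s t).weight w (inLeft s t (s.child₁ p)) +
        (node s t).weight w (inLeft s t (s.child₂ p)) = _
      rw [weight_inLeft, weight_inLeft, hs]
      rfl
    · change (node s t).weight w (inRight s t (t.child₁ p)) +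
        (node s t).weight w (inRight s t (t.child₂ p)) = _
      rw [weight_inRight, weight_inRight, ht]
      rfl

theorem nonempty {n : ℕ} (t : PlaneTree n) : Nonempty (Fin n) := by
  induction t with
  | leaf => exact ⟨0⟩
  | node s t hs ht => exact hs.map (Fin.castAdd _)

theorem weight_pos {n : ℕ} (t : PlaneTree n) (w : Fin n → ℝ) (hw : ∀ i, 0 < w i)
    (x : Fin n ⊕ t.Inner) : 0 < t.weight w x := by
  rcases x with i | p
  · exact hw i
  · induction t with
    | leaf => exact p.elim
    | @node m n s t hs ht =>
      rcases p with _ | p | p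
      · rw [← weight_child]
        change 0 < (node s t).weight w (inLeft s t s.root) +
          (node s t).weight w (inRight s t t.root)
        rw [weight_inLeft, weight_inRight, weight_root, weight_root]
        have := s.nonempty
        have := t.nonempty
        exact add_pos (Finset.sum_pos (fun _ _ => hw _) Finset.univ_nonempty)
          (Finset.sum_pos (fun _ _ => hw _) Finset.univ_nonempty)
      · exact hs _ (fun i => hw _) p
      · exact ht _ (fun i => hw _) p

theorem inLeft_injective {m n : ℕ} (s : PlaneTree m) (t : PlaneTree n) :
    Function.Injective (inLeft s t) :=
  Sum.map_injective.2 ⟨Fin.castAdd_injective m n,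
    fun _ _ h => Sum.inl_injective (Option.some_injective _ h)⟩

theorem inRight_injective {m n : ℕ} (s : PlaneTree m) (t : PlaneTree n) :
    Function.Injective (inRight s t) :=
  Sum.map_injective.2 ⟨Fin.natAdd_injective n m,
    fun _ _ h => Sum.inr_injective (Option.some_injective _ h)⟩

theorem inLeft_ne_inRight {m n : ℕ} (s : PlaneTree m) (t : PlaneTree n) (x y) :
    inLeft s t x ≠ inRight s t y := by
  rcases x with x | x <;> rcases y with y | y <;> intro h
  · have h' : Fin.castAdd n x = Fin.natAdd m y := Sum.inl_injective h
    have := congrArg Fin.val h'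
    simp only [Fin.val_castAdd, Fin.val_natAdd] at this
    omega
  · cases h
  · cases h
  · have h' := Option.some_injective _ (Sum.inr_injective h)
    cases h'

theorem inLeft_ne_root {m n : ℕ} (s : PlaneTree m) (t : PlaneTree n) (x) :
    inLeft s t x ≠ (node s t).root := by
  rcases x with x | x <;> intro h
  · cases h
  · have h' := Sum.inr_injective h
    cases h'

theorem inRight_ne_root {m n : ℕ} (s : PlaneTree m) (t : PlaneTree n) (x) :
    inRight s t x ≠ (node s t).root := by
  rcases x with x | x <;> intro h
  · cases h
  · have h' := Sum.inr_injective h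
    cases h'

/-- The root, the left children and the right children. -/
def rootOrChild {n : ℕ} (t : PlaneTree n) : Unit ⊕ (t.Inner ⊕ t.Inner) → Fin n ⊕ t.Inner :=
  Sum.elim (fun _ => t.root) (Sum.elim t.child₁ t.child₂)

/-- Every leaf and every inner vertex is either the root or a child of an inner vertex, in exactly
one way. -/
theorem rootOrChild_bijective {n : ℕ} (t : PlaneTree n) : Function.Bijective t.rootOrChild := by
  induction t with
  | leaf =>
    constructor
    · rintro (_ | x | x) (_ | y | y) _
      all_goals first | rfl | exact x.elim | exact y.elim
    · rintro (x | x)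
      · exact ⟨.inl (), congrArg Sum.inl (Subsingleton.elim _ _)⟩
      · exact x.elim
  | @node m n s t hs ht =>
    -- the same map, grouped by the subtrees
    let k : Unit ⊕ (Option (s.Inner ⊕ t.Inner) ⊕ Option (s.Inner ⊕ t.Inner)) →
        Unit ⊕ ((Unit ⊕ (s.Inner ⊕ s.Inner)) ⊕ (Unit ⊕ (t.Inner ⊕ t.Inner))) := fun x =>
      match x with
      | .inl _ => .inl ()
      | .inr (.inl none) => .inr (.inl (.inl ()))
      | .inr (.inr none) => .inr (.inr (.inl ()))
      | .inr (.inl (some (.inl p))) => .inr (.inl (.inr (.inl p)))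
      | .inr (.inr (some (.inl p))) => .inr (.inl (.inr (.inr p)))
      | .inr (.inl (some (.inr p))) => .inr (.inr (.inr (.inl p)))
      | .inr (.inr (some (.inr p))) => .inr (.inr (.inr (.inr p)))
    have hk : Function.Bijective k := by
      constructor
      · rintro (_ | (_ | p | p) | (_ | p | p)) (_ | (_ | p' | p') | (_ | p' | p')) h <;>
          simp_all [k]
      · rintro (_ | (_ | p | p) | (_ | p | p))
        exacts [⟨.inl (), rfl⟩, ⟨.inr (.inl none), rfl⟩, ⟨.inr (.inl (some (.inl p))), rfl⟩,
          ⟨.inr (.inr (some (.inl p))), rfl⟩, ⟨.inr (.inr none), rfl⟩,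
          ⟨.inr (.inl (some (.inr p))), rfl⟩, ⟨.inr (.inr (some (.inr p))), rfl⟩]
    let g : Unit ⊕ ((Fin m ⊕ s.Inner) ⊕ (Fin n ⊕ t.Inner)) → Fin (m + n) ⊕ (node s t).Inner :=
      Sum.elim (fun _ => (node s t).root) (Sum.elim (inLeft s t) (inRight s t))
    have hg : Function.Bijective g := by
      constructor
      · rintro (_ | x | x) (_ | y | y) h
        · rfl
        · exact absurd h.symm (inLeft_ne_root s t y)
        · exact absurd h.symm (inRight_ne_root s t y)
        · exact absurd h (inLeft_ne_root s t x)
        · exact congrArg (fun z => Sum.inr (Sum.inl z)) (inLeft_injective s t h)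
        · exact absurd h (inLeft_ne_inRight s t x y)
        · exact absurd h (inRight_ne_root s t x)
        · exact absurd h.symm (inLeft_ne_inRight s t y x)
        · exact congrArg (fun z => Sum.inr (Sum.inr z)) (inRight_injective s t h)
      · rintro (i | _ | p | p)
        · refine Fin.addCases (fun i => ?_) (fun i => ?_) i
          · exact ⟨.inr (.inl (.inl i)), rfl⟩
          · exact ⟨.inr (.inr (.inl i)), rfl⟩
        · exact ⟨.inl (), rfl⟩
        · exact ⟨.inr (.inl (.inr p)), rfl⟩
        · exact ⟨.inr (.inr (.inr p)), rfl⟩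
    have := (hg.comp (Function.bijective_id.sumMap (hs.sumMap ht))).comp hk
    refine Eq.mp (congrArg Function.Bijective ?_) this
    funext x
    rcases x with _ | (_ | p | p) | (_ | p | p) <;> rfl

end PlaneTree

namespace IETData

variable (D : IETData) (s m : PlaneTree D.r)

/-- The edge of the one-foam `closedFoam` below that leads to a leaf or an inner vertex of the
splitting tree. -/
def splitEdge : Fin D.r ⊕ s.Inner → Fin D.r ⊕ (s.Inner ⊕ m.Inner) :=
  Sum.map id Sum.inl

/-- The edge of the one-foam `closedFoam` below that comes from a leaf or an inner vertex of the
merging tree. The strand `i` comes in at the `σ(i)`-th leaf of the merging tree. -/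
def mergeEdge : Fin D.r ⊕ m.Inner → Fin D.r ⊕ (s.Inner ⊕ m.Inner) :=
  Sum.map D.perm.symm Sum.inr

/-- The weights of the edges of the one-foam `closedFoam` below. -/
noncomputable def edgeWeight : Fin D.r ⊕ (s.Inner ⊕ m.Inner) → ℝ :=
  Sum.elim D.len
    (Sum.elim (s.innerWeight D.len) (m.innerWeight fun i => D.len (D.perm.symm i)))

theorem weight_splitEdge (x) : D.edgeWeight s m (D.splitEdge s m x) = s.weight D.len x := by
  rcases x with x | x <;> rfl

theorem weight_mergeEdge (x) : D.edgeWeight s m (D.mergeEdge s m x) =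
    m.weight (fun i => D.len (D.perm.symm i)) x := by
  rcases x with x | x <;> rfl

/-- The closed one-foam of an interval exchange transformation `T_{λ,σ}`: a line of weight `1` is
split into lines of weights `λ_1, …, λ_r`, from left to right, by the sequence of splits that the
tree `s` prescribes; the resulting lines are permuted by `σ` and merged, by the sequence of merges
that the tree `m` prescribes, into a line of weight `1`, the end of which is then joined with the
beginning. The edges are the `r` lines in the middle, the edges that go into the splits and the
edges that come out of the merges; the point where the diagram is closed up is a bivalent point. At
every vertex the order of the two thin edges is from left to right. -/
noncomputable def closedFoam : OneFoam where
  Edge := Fin D.r ⊕ (s.Inner ⊕ m.Inner)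
  Reg := Unit
  Merge := m.Inner
  Split := s.Inner
  weight := D.edgeWeight s m
  weight_pos := by
    rintro (i | p | p)
    · exact D.len_pos i
    · exact s.weight_pos D.len D.len_pos (.inr p)
    · exact m.weight_pos _ (fun i => D.len_pos _) (.inr p)
  regIn := fun _ => D.mergeEdge s m m.root
  regOut := fun _ => D.splitEdge s m s.root
  mergeIn₁ := fun p => D.mergeEdge s m (m.child₁ p)
  mergeIn₂ := fun p => D.mergeEdge s m (m.child₂ p)
  mergeOut := fun p => .inr (.inr p)
  splitIn := fun p => .inr (.inl p)
  splitOut₁ := fun p => D.splitEdge s m (s.child₁ p)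
  splitOut₂ := fun p => D.splitEdge s m (s.child₂ p)
  target_bij := by
    have := (((Equiv.sumAssoc _ _ _).trans
      (Equiv.sumCongr D.perm.symm (Equiv.sumComm m.Inner s.Inner))).bijective.comp
      (m.rootOrChild_bijective.sumMap (Function.bijective_id (α := s.Inner)))).comp
      ((Equiv.sumCongr (Equiv.refl _) (Equiv.sumAssoc _ _ _).symm).trans
        (Equiv.sumAssoc _ _ _).symm).bijective
    refine Eq.mp (congrArg Function.Bijective ?_) this
    funext x
    rcases x with x | x | x | x
    · change _ = D.mergeEdge s m m.root
      simp only [Function.comp, mergeEdge]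
      rcases h : m.root with y | y <;> simp [PlaneTree.rootOrChild, h]
    · change _ = D.mergeEdge s m (m.child₁ x)
      simp only [Function.comp, mergeEdge]
      rcases h : m.child₁ x with y | y <;> simp [PlaneTree.rootOrChild, h]
    · change _ = D.mergeEdge s m (m.child₂ x)
      simp only [Function.comp, mergeEdge]
      rcases h : m.child₂ x with y | y <;> simp [PlaneTree.rootOrChild, h]
    · rfl
  source_bij := by
    have := ((Equiv.sumAssoc (Fin D.r) s.Inner m.Inner).bijective.comp
      (s.rootOrChild_bijective.sumMap (Function.bijective_id (α := m.Inner)))).comp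
      ((Equiv.sumCongr (Equiv.refl _) (Equiv.sumAssoc _ _ _).symm).trans
        (Equiv.sumAssoc _ _ _).symm).bijective
    refine Eq.mp (congrArg Function.Bijective ?_) this
    funext x
    rcases x with x | x | x | x
    · change _ = D.splitEdge s m s.root
      simp only [Function.comp, splitEdge]
      rcases h : s.root with y | y <;> simp [PlaneTree.rootOrChild, h]
    · change _ = D.splitEdge s m (s.child₁ x)
      simp only [Function.comp, splitEdge]
      rcases h : s.child₁ x with y | y <;> simp [PlaneTree.rootOrChild, h]
    · change _ = D.splitEdge s m (s.child₂ x)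
      simp only [Function.comp, splitEdge]
      rcases h : s.child₂ x with y | y <;> simp [PlaneTree.rootOrChild, h]
    · rfl
  reg_weight := fun _ => by
    rw [weight_mergeEdge, weight_splitEdge, PlaneTree.weight_root, PlaneTree.weight_root]
    exact Equiv.sum_comp D.perm.symm D.len
  merge_weight := fun p => by
    rw [weight_mergeEdge, weight_mergeEdge, PlaneTree.weight_child]
    rfl
  split_weight := fun p => by
    rw [weight_splitEdge, weight_splitEdge, PlaneTree.weight_child]
    rfl

end IETData

/-! Modulo the relation at a vertex of a two-foam, a one-foam is determined up to cobordism by the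
signed sum of the pairs of thin weights at its vertices. The relation is the cocycle equation
`f a b + f (a + b) c = f b c + f a (b + c)`. The commutator of a cocycle `f` is biadditive, and half
of it is a biadditive map `β` on the positive reals such that `f - β` is a symmetric cocycle. A
symmetric cocycle has the same sum over all trees with the same leaves in any order, so it cancels
between the splits and the merges. The sum of `β` depends on the tree only through the order of its
leaves, and the difference between splits and merges is, up to sign, the image under `β` of the
Sah–Arnoux–Fathi invariant: the integral of `(T x - x) ⊗ dx`. As interval exchange transformations
preserve Lebesgue measure, this invariant takes compositions to sums. -/

/-! ### Two-cocycles on commutative semigroups -/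

/-- The two-cocycles with trivial coefficients on an additive semigroup, in the sense of the bar
complex. -/
def IsTwoCocycle {S M : Type*} [Add S] [Add M] (f : S → S → M) : Prop :=
  ∀ a b c, f a b + f (a + b) c = f b c + f a (b + c)

namespace IsTwoCocycle

variable {S M : Type*} [AddCommSemigroup S] [AddCommGroup M] {f : S → S → M}

theorem commutator_add_left (hf : IsTwoCocycle f) (a b c : S) :
    f (a + b) c - f c (a + b) = (f a c - f c a) + (f b c - f c b) := by
  have habc := hf a b c
  have hcab := hf c a b
  have hacb := hf a c b
  rw [add_comm c a] at hcab
  rw [add_comm c b] at hacb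
  linear_combination (norm := module) habc + hcab - hacb

theorem commutator_add_right (hf : IsTwoCocycle f) (a b c : S) :
    f a (b + c) - f (b + c) a = (f a b - f b a) + (f a c - f c a) := by
  linear_combination (norm := module) -hf.commutator_add_left b c a

end IsTwoCocycle

section PositiveCone

variable {G M : Type*} [AddCommGroup G] [LinearOrder G] [IsOrderedAddMonoid G] [AddCommGroup M]

theorem addMonoidHom_ext_of_pos {f g : G →+ M} (h : ∀ a, 0 < a → f a = g a) : f = g := by
  ext x
  rcases lt_trichotomy x 0 with hx | rfl | hx
  · rw [← neg_inj, ← map_neg, ← map_neg, h _ (neg_pos.2 hx)]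
  · rw [map_zero, map_zero]
  · exact h x hx

variable [Nontrivial G]

theorem exists_addMonoidHom_eq_of_pos (f : {x : G // 0 < x} → M)
    (hf : ∀ a b, f (a + b) = f a + f b) : ∃ g : G →+ M, ∀ a : {x : G // 0 < x}, g a = f a := by
  have sub_eq_sub : ∀ p q p' q' : {x : G // 0 < x},
      (p : G) - q = p' - q' → f p - f q = f p' - f q' := by
    intro p q p' q' h
    rw [sub_eq_sub_iff_add_eq_add] at h ⊢
    rw [← hf, ← hf, show p + q' = p' + q from Subtype.ext h]
  have exists_sub : ∀ x : G, ∃ p q : {x : G // 0 < x}, (p : G) - q = x := by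
    intro x
    obtain ⟨e, he⟩ := exists_zero_lt (α := G)
    refine ⟨⟨x + (|x| + e), ?_⟩, ⟨|x| + e, by positivity⟩, add_sub_cancel_right _ _⟩
    rw [← add_assoc]
    exact add_pos_of_nonneg_of_pos (neg_le_iff_add_nonneg'.1 (neg_le_abs x)) he
  choose p q hpq using exists_sub
  refine ⟨AddMonoidHom.mk' (fun x => f (p x) - f (q x)) fun x y => ?_, fun a => ?_⟩
  · rw [sub_add_sub_comm, ← hf, ← hf]
    refine sub_eq_sub _ _ _ _ ?_
    rw [hpq, Positive.coe_add, Positive.coe_add, add_sub_add_comm, hpq, hpq]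
  · have h := sub_eq_sub (p a) (q a) (a + a) a (by
      rw [hpq, Positive.coe_add, add_sub_cancel_right])
    rwa [hf, add_sub_cancel_right] at h

theorem exists_biadditive_eq_of_pos (b : {x : G // 0 < x} → {x : G // 0 < x} → M)
    (add_left : ∀ x y z, b (x + y) z = b x z + b y z)
    (add_right : ∀ x y z, b x (y + z) = b x y + b x z) :
    ∃ β : G →+ G →+ M, ∀ x y : {x : G // 0 < x}, β x y = b x y := by
  choose g hg using fun x => exists_addMonoidHom_eq_of_pos (b x) (add_right x)
  obtain ⟨β, hβ⟩ := exists_addMonoidHom_eq_of_pos g fun x y =>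
    addMonoidHom_ext_of_pos fun z hz => by
      rw [AddMonoidHom.add_apply, hg _ ⟨z, hz⟩, hg _ ⟨z, hz⟩, hg _ ⟨z, hz⟩, add_left]
  exact ⟨β, fun x y => by rw [hβ, hg]⟩

end PositiveCone

open scoped TensorProduct in
theorem IsTwoCocycle.exists_symm_sub_tmul {K M : Type*} [Field K] [LinearOrder K]
    [IsStrictOrderedRing K] [AddCommGroup M] {f : {x : K // 0 < x} → {x : K // 0 < x} → M}
    (hf : IsTwoCocycle f) : ∃ Φ : K ⊗[ℤ] K →+ M, ∀ a b : {x : K // 0 < x},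
      f a b - Φ ((a : K) ⊗ₜ (b : K)) = f b a - Φ ((b : K) ⊗ₜ (a : K)) := by
  obtain ⟨β, hβ⟩ := exists_biadditive_eq_of_pos (fun a b => f a b - f b a)
    hf.commutator_add_left hf.commutator_add_right
  let Φ : K ⊗[ℤ] K →+ M := TensorProduct.liftAddHom
    (β.compl₂ (AddMonoidHom.mulRight (2⁻¹ : K))) fun r x y => by
      rw [map_zsmul, map_zsmul, AddMonoidHom.zsmul_apply]
  have Φ_tmul : ∀ x y, Φ (x ⊗ₜ y) = β x (y * 2⁻¹) := fun x y => by
    simp [Φ]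
  have add_self : ∀ x y, β x (y * 2⁻¹) + β x (y * 2⁻¹) = β x y := fun x y => by
    rw [← map_add, ← div_eq_mul_inv, add_halves]
  have half_swap : ∀ x y, β x (y * 2⁻¹) = β (x * 2⁻¹) y := fun x y => by
    rw [← add_self _ y, ← AddMonoidHom.add_apply, ← map_add, ← div_eq_mul_inv x, add_halves]
  have skew : ∀ a b : {x : K // 0 < x}, β b a = -β a b := fun a b => by rw [hβ, hβ, neg_sub]
  have skew_half : ∀ a b : {x : K // 0 < x}, β b (a * 2⁻¹) = -β a (b * 2⁻¹) := fun a b => by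
    rw [half_swap a]
    exact skew ⟨a * 2⁻¹, mul_pos a.2 (by positivity)⟩ b
  refine ⟨Φ, fun a b => ?_⟩
  have hab := add_self a b
  rw [hβ] at hab
  rw [Φ_tmul, Φ_tmul, skew_half a b]
  linear_combination (norm := module) -hab

/-- The extension of a semigroup `S` by a group `M` with trivial action that is defined by `ω`. It
is associative if `ω` is a two-cocycle, and commutative if `S` is and `ω` is symmetric. -/
structure CocycleExtension {S M : Type*} (ω : S → S → M) where
  fiber : M
  base : S

namespace CocycleExtension

variable {S M : Type*} [AddCommSemigroup S] [AddCommGroup M] {ω : S → S → M}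

instance : Add (CocycleExtension ω) :=
  ⟨fun p q => ⟨p.fiber + q.fiber + ω p.base q.base, p.base + q.base⟩⟩

theorem mk_add_mk (x y : M) (a b : S) :
    (⟨x, a⟩ + ⟨y, b⟩ : CocycleExtension ω) = ⟨x + y + ω a b, a + b⟩ := rfl

/-- The commutative extension that is defined by a symmetric two-cocycle. -/
abbrev addCommSemigroup (hω : IsTwoCocycle ω) (symm : ∀ a b, ω a b = ω b a) :
    AddCommSemigroup (CocycleExtension ω) where
  add_assoc := by
    rintro ⟨x, a⟩ ⟨y, b⟩ ⟨z, c⟩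
    simp only [mk_add_mk, mk.injEq, add_assoc, and_true]
    linear_combination (norm := module) hω a b c
  add_comm := by
    rintro ⟨x, a⟩ ⟨y, b⟩
    rw [mk_add_mk, mk_add_mk, add_comm x, add_comm a, symm]

end CocycleExtension

/-! ### Sums over plane trees -/

namespace PlaneTree

section Fold

variable {E : Type*}

/-- The sum of a family of elements, bracketed as the tree prescribes. -/
def fold [Add E] : {n : ℕ} → PlaneTree n → (Fin n → E) → E
  | _, leaf, x => x 0
  | _, node (m := m) (n := n) s t, x =>
    s.fold (x ∘ Fin.castAdd n) + t.fold (x ∘ Fin.natAdd m)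

theorem coe_fold [AddCommSemigroup E] {n : ℕ} (t : PlaneTree n) (x : Fin n → E) :
    ((t.fold x : E) : WithZero E) = ∑ i, (x i : WithZero E) := by
  induction t with
  | leaf => exact (Fin.sum_univ_one fun i => (x i : WithZero E)).symm
  | node s t hs ht =>
    rw [fold, WithZero.coe_add, hs, ht, Fin.sum_univ_add]
    rfl

theorem fold_comp_perm [AddCommSemigroup E] {n : ℕ} (s t : PlaneTree n) (x : Fin n → E)
    (σ : Equiv.Perm (Fin n)) : t.fold (x ∘ σ) = s.fold x := by
  rw [← WithZero.coe_inj, coe_fold, coe_fold]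
  exact Equiv.sum_comp σ fun i => (x i : WithZero E)

theorem map_fold {F G : Type*} [Add E] [AddCommMonoid F] [FunLike G E F] [AddHomClass G E F]
    (g : G) {n : ℕ} (t : PlaneTree n) (x : Fin n → E) : g (t.fold x) = ∑ i, g (x i) := by
  induction t with
  | leaf => exact (Fin.sum_univ_one fun i => g (x i)).symm
  | node s t hs ht =>
    rw [fold, map_add, hs, ht, Fin.sum_univ_add]
    rfl

end Fold

section InnerSum

variable {S M : Type*} [Add S]

/-- The sum of `f a b` over the inner vertices of a tree with weighted leaves, where `a` and `b` are
the weights of the two children. -/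
def innerSum [Add M] [Zero M] (f : S → S → M) : {n : ℕ} → PlaneTree n → (Fin n → S) → M
  | _, leaf, _ => 0
  | _, node (m := m) (n := n) s t, w =>
    s.innerSum f (w ∘ Fin.castAdd n) + t.innerSum f (w ∘ Fin.natAdd m) +
      f (s.fold (w ∘ Fin.castAdd n)) (t.fold (w ∘ Fin.natAdd m))

variable [AddCommGroup M] {n : ℕ} (t : PlaneTree n)

theorem innerSum_sub (f g : S → S → M) (w : Fin n → S) :
    t.innerSum (fun a b => f a b - g a b) w = t.innerSum f w - t.innerSum g w := by
  induction t with
  | leaf => exact (sub_zero 0).symm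
  | node s t hs ht =>
    simp only [innerSum, hs, ht]
    abel

theorem map_innerSum {N : Type*} [AddCommGroup N] (g : M →+ N) (f : S → S → M) (w : Fin n → S) :
    g (t.innerSum f w) = t.innerSum (fun a b => g (f a b)) w := by
  induction t with
  | leaf => exact map_zero g
  | node s t hs ht => simp only [innerSum, map_add, hs, ht]

open scoped TensorProduct in
theorem innerSum_tmul {G : Type*} [AddCommGroup G] (ι : AddHom S G) (w : Fin n → S) :
    t.innerSum (fun a b => ι a ⊗ₜ[ℤ] ι b) w = ∑ j, (∑ i with i < j, ι (w i)) ⊗ₜ[ℤ] ι (w j) := by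
  induction t with
  | leaf => simp [innerSum]
  | @node p q s t hs ht =>
    have castAdd_lt_castAdd (i j : Fin p) : Fin.castAdd q i < Fin.castAdd q j ↔ i < j := Iff.rfl
    have castAdd_lt_natAdd (i : Fin p) (j : Fin q) : Fin.castAdd q i < Fin.natAdd p j :=
      Fin.lt_def.2 (i.2.trans_le (Nat.le_add_right p j))
    have natAdd_not_lt (i : Fin q) (j : Fin p) : ¬ Fin.natAdd p i < Fin.castAdd q j :=
      (castAdd_lt_natAdd j i).asymm
    simp only [innerSum, hs, ht, map_fold, Finset.sum_filter, Fin.sum_univ_add,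
      TensorProduct.add_tmul, TensorProduct.tmul_sum, TensorProduct.zero_tmul,
      Finset.sum_add_distrib, Function.comp_apply, castAdd_lt_castAdd, Fin.natAdd_lt_natAdd_iff,
      castAdd_lt_natAdd, natAdd_not_lt, if_true, if_false, Finset.sum_const_zero]
    abel

end InnerSum

section Cocycle

variable {S M : Type*} [AddCommSemigroup S] [AddCommGroup M] {n : ℕ}

theorem fold_cocycleExtension (ω : S → S → M) (t : PlaneTree n) (w : Fin n → S) :
    t.fold (fun i => (⟨0, w i⟩ : CocycleExtension ω)) = ⟨t.innerSum ω w, t.fold w⟩ := by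
  induction t with
  | leaf => rfl
  | node s t hs ht => exact congrArg₂ (· + ·) (hs _) (ht _)

theorem innerSum_comp_perm {ω : S → S → M} (hω : IsTwoCocycle ω) (symm : ∀ a b, ω a b = ω b a)
    (s t : PlaneTree n) (w : Fin n → S) (σ : Equiv.Perm (Fin n)) :
    t.innerSum ω (w ∘ σ) = s.innerSum ω w := by
  let _ := CocycleExtension.addCommSemigroup hω symm
  have h := fold_comp_perm s t (fun i => (⟨0, w i⟩ : CocycleExtension ω)) σ
  exact congrArg CocycleExtension.fiber
    ((fold_cocycleExtension ω t (w ∘ σ)).symm.trans (h.trans (fold_cocycleExtension ω s w)))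

end Cocycle

end PlaneTree

/-! ### The universal two-cocycle -/

section FiniteFamilies

theorem exists_sum_sub_sum_of_mem_closure_range {ι G : Type*} [AddCommGroup G] {f : ι → G} {x : G}
    (hx : x ∈ AddSubgroup.closure (Set.range f)) :
    ∃ (p n : ℕ) (P : Fin p → ι) (N : Fin n → ι), x = ∑ v, f (P v) - ∑ v, f (N v) := by
  induction hx using AddSubgroup.closure_induction with
  | mem x hx =>
    obtain ⟨i, rfl⟩ := hx
    exact ⟨1, 0, fun _ => i, Fin.elim0, by simp⟩
  | zero => exact ⟨0, 0, Fin.elim0, Fin.elim0, by simp⟩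
  | add x y _ _ hx hy =>
    obtain ⟨p, n, P, N, rfl⟩ := hx
    obtain ⟨p', n', P', N', rfl⟩ := hy
    refine ⟨p + p', n + n', Fin.append P P', Fin.append N N', ?_⟩
    simp only [Fin.sum_univ_add, Fin.append_left, Fin.append_right, add_sub_add_comm]
  | neg x _ hx =>
    obtain ⟨p, n, P, N, rfl⟩ := hx
    exact ⟨n, p, N, P, neg_sub _ _⟩

theorem exists_equiv_of_sum_single_eq {R α β γ : Type*} [AddCommMonoidWithOne R] [CharZero R]
    [Fintype α] [Fintype β] (f : α → γ) (g : β → γ)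
    (h : ∑ a, Finsupp.single (f a) (1 : R) = ∑ b, Finsupp.single (g b) (1 : R)) :
    ∃ e : α ≃ β, ∀ a, g (e a) = f a := by
  classical
  have equiv_fiber (c : γ) : Nonempty ({a // f a = c} ≃ {b // g b = c}) := by
    have hc := DFunLike.congr_fun h c
    simp only [Finsupp.finsetSum_apply, Finsupp.single_apply, Finset.sum_boole] at hc
    refine ⟨Fintype.equivOfCardEq ?_⟩
    rw [Fintype.card_subtype, Fintype.card_subtype]
    exact_mod_cast hc
  exact ⟨Equiv.ofFiberEquiv fun c => (equiv_fiber c).some, Equiv.ofFiberEquiv_map _⟩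

theorem finsum_sum_type {α β M : Type*} [Finite α] [Finite β] [AddCommMonoid M] (f : α ⊕ β → M) :
    ∑ᶠ x, f x = ∑ᶠ a, f (.inl a) + ∑ᶠ b, f (.inr b) := by
  have := Fintype.ofFinite α
  have := Fintype.ofFinite β
  simp only [finsum_eq_sum_of_fintype, Fintype.sum_sum_type]

end FiniteFamilies

section Bar

variable {S : Type*} [Add S]

/-- The thin weights along the seam `a` at a vertex with thin facets of weights `x`. -/
def seamA (x : S × S × S) : S × S := (x.1, x.2.1)

/-- The thin weights along the seam `b` at a vertex with thin facets of weights `x`. -/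
def seamB (x : S × S × S) : S × S := (x.2.1, x.2.2)

/-- The thin weights along the seam `c` at a vertex with thin facets of weights `x`. -/
def seamC (x : S × S × S) : S × S := (x.1 + x.2.1, x.2.2)

/-- The thin weights along the seam `d` at a vertex with thin facets of weights `x`. -/
def seamD (x : S × S × S) : S × S := (x.1, x.2.1 + x.2.2)

/-- The signed sum of the seams that end at a vertex of a two-foam: up to sign, the boundary of a
three-cell in the bar complex of `S`. -/
noncomputable def vertexRelation (x : S × S × S) : S × S →₀ ℤ :=
  .single (seamA x) 1 + .single (seamC x) 1 - (.single (seamB x) 1 + .single (seamD x) 1)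

variable (S) in
/-- The two-chains of the bar complex of `S` modulo boundaries. -/
abbrev TwoChainQuotient : Type _ :=
  (S × S →₀ ℤ) ⧸ AddSubgroup.closure (Set.range (vertexRelation (S := S)))

/-- The universal two-cocycle on `S`. -/
noncomputable def universalCocycle (a b : S) : TwoChainQuotient S :=
  QuotientAddGroup.mk' _ (.single (a, b) 1)

theorem isTwoCocycle_universalCocycle : IsTwoCocycle (universalCocycle (S := S)) := by
  intro a b c
  have hmem : vertexRelation (a, b, c) ∈ AddSubgroup.closure (Set.range vertexRelation) :=
    AddSubgroup.subset_closure (Set.mem_range_self _)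
  have h := (QuotientAddGroup.eq_zero_iff _).2 hmem
  exact sub_eq_zero.1 h

end Bar

/-! ### One-foams up to cobordism -/

/-- Positive real numbers: the weights of edges and facets. -/
abbrev PosReal : Type := {x : ℝ // 0 < x}

namespace OneFoam

variable (U V : OneFoam)

/-- The weight of an edge as a positive real number. -/
def posWeight (e : U.Edge) : PosReal := ⟨U.weight e, U.weight_pos e⟩

/-- The weights of the two thin edges at a split. -/
def splitType (s : U.Split) : PosReal × PosReal :=
  (U.posWeight (U.splitOut₁ s), U.posWeight (U.splitOut₂ s))

/-- The weights of the two thin edges at a merge. -/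
def mergeType (m : U.Merge) : PosReal × PosReal :=
  (U.posWeight (U.mergeIn₁ m), U.posWeight (U.mergeIn₂ m))

variable {M : Type*} [AddCommGroup M] (f : PosReal → PosReal → M)

/-- The signed sum of a function of the thin weights over the vertices of a one-foam, where splits
count positively and merges negatively. -/
noncomputable def vertexSum : M :=
  ∑ᶠ s, f.uncurry (U.splitType s) - ∑ᶠ m, f.uncurry (U.mergeType m)

theorem vertexSum_reverse : U.reverse.vertexSum f = -U.vertexSum f :=
  (neg_sub _ _).symm

theorem vertexSum_union : (U.union V).vertexSum f = U.vertexSum f + V.vertexSum f :=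
  (congrArg₂ (· - ·) (finsum_sum_type _) (finsum_sum_type _)).trans (add_sub_add_comm _ _ _ _)

theorem map_vertexSum {N : Type*} [AddCommGroup N] (g : M →+ N) :
    g (U.vertexSum f) = U.vertexSum fun a b => g (f a b) := by
  rw [vertexSum, map_sub, g.map_finsum (Set.toFinite _), g.map_finsum (Set.toFinite _)]
  rfl

end OneFoam

theorem VertexMatch.of_comp_injective {Seam Facet Facet' : Type} {thin₁ thin₂ thick : Seam → Facet}
    {j : Facet → Facet'} (hj : Function.Injective j) {a b c d : Seam}
    (h : VertexMatch (j ∘ thin₁) (j ∘ thin₂) (j ∘ thick) a b c d) :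
    VertexMatch thin₁ thin₂ thick a b c d := by
  simpa only [VertexMatch, Function.comp_apply, hj.eq_iff] using h

theorem vertexMatch_of_thin {Seam S : Type} [AddSemigroup S] {thin : Seam → S × S} {a b c d : Seam}
    (x : S × S × S) (ha : thin a = seamA x) (hb : thin b = seamB x) (hc : thin c = seamC x)
    (hd : thin d = seamD x) :
    VertexMatch (fun s => (thin s).1) (fun s => (thin s).2) (fun s => (thin s).1 + (thin s).2)
      a b c d := by
  simp only [VertexMatch, ha, hb, hc, hd, seamA, seamB, seamC, seamD, add_assoc, and_self]

namespace TwoFoam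

section OfMatching

variable (U : OneFoam) {VertP VertN : Type} (P : VertP → PosReal × PosReal × PosReal)
  (N : VertN → PosReal × PosReal × PosReal)

/-- The thin weights at the terminal ends of the seams of a two-foam without bivalent points that
has boundary `U` and has vertices of the two kinds with thin weights `P` and `N`. -/
def terminalType : Empty ⊕ (VertP ⊕ (VertP ⊕ (VertN ⊕ (VertN ⊕ U.Split)))) → PosReal × PosReal :=
  Sum.elim Empty.elim (Sum.elim (seamA ∘ P) (Sum.elim (seamC ∘ P)
    (Sum.elim (seamB ∘ N) (Sum.elim (seamD ∘ N) U.splitType))))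

/-- The thin weights at the initial ends of the seams of such a two-foam. -/
def initialType : Empty ⊕ (VertN ⊕ (VertN ⊕ (VertP ⊕ (VertP ⊕ U.Merge)))) → PosReal × PosReal :=
  Sum.elim Empty.elim (Sum.elim (seamA ∘ N) (Sum.elim (seamC ∘ N)
    (Sum.elim (seamB ∘ P) (Sum.elim (seamD ∘ P) U.mergeType))))

/-- The weights of the sides of the facets of such a two-foam: the sides along the edges of `U`, and
the first thin, second thin and thick sides along the seams. -/
def sideWeight : U.Edge ⊕ ((Empty ⊕ (VertP ⊕ (VertP ⊕ (VertN ⊕ (VertN ⊕ U.Split))))) × Fin 3) →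
    PosReal :=
  Sum.elim U.posWeight fun s => ![(terminalType U P N s.1).1, (terminalType U P N s.1).2,
    (terminalType U P N s.1).1 + (terminalType U P N s.1).2] s.2

variable {U P N} [Finite VertP] [Finite VertN]

/-- The two-foam that arises from joining initial and terminal ends of equal type to seams, with one
facet for each weight. -/
noncomputable def ofMatching
    (e : Empty ⊕ (VertN ⊕ (VertN ⊕ (VertP ⊕ (VertP ⊕ U.Merge)))) ≃
      Empty ⊕ (VertP ⊕ (VertP ⊕ (VertN ⊕ (VertN ⊕ U.Split)))))
    (he : ∀ x, terminalType U P N (e x) = initialType U P N x) : TwoFoam U where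
  Facet := Set.range (sideWeight U P N)
  Seam := Empty ⊕ (VertP ⊕ (VertP ⊕ (VertN ⊕ (VertN ⊕ U.Split))))
  Point := Empty
  VertP := VertP
  VertN := VertN
  genus _ := 0
  weight f := f.1.1
  weight_pos f := f.1.2
  thin₁ s := Set.rangeFactorization (sideWeight U P N) (.inr (s, 0))
  thin₂ s := Set.rangeFactorization (sideWeight U P N) (.inr (s, 1))
  thick s := Set.rangeFactorization (sideWeight U P N) (.inr (s, 2))
  seam_weight s := rfl
  side s := Set.rangeFactorization (sideWeight U P N) (.inl s)
  side_weight s := rfl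
  pointIn := Empty.elim
  pointOut := Empty.elim
  aP v := .inr (.inl v)
  cP v := .inr (.inr (.inl v))
  bN v := .inr (.inr (.inr (.inl v)))
  dN v := .inr (.inr (.inr (.inr (.inl v))))
  atSplit v := .inr (.inr (.inr (.inr (.inr v))))
  aN v := e (.inr (.inl v))
  cN v := e (.inr (.inr (.inl v)))
  bP v := e (.inr (.inr (.inr (.inl v))))
  dP v := e (.inr (.inr (.inr (.inr (.inl v)))))
  atMerge v := e (.inr (.inr (.inr (.inr (.inr v)))))
  target_bij := by
    convert Function.bijective_id using 1
    funext x
    rcases x with x | x | x | x | x | x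
    exacts [x.elim, rfl, rfl, rfl, rfl, rfl]
  source_bij := by
    convert e.bijective using 1
    funext x
    rcases x with x | x | x | x | x | x
    exacts [x.elim, rfl, rfl, rfl, rfl, rfl]
  point_match v := v.elim
  vertP_match v := .of_comp_injective Subtype.val_injective
    (vertexMatch_of_thin (P v) rfl (he _) rfl (he _))
  vertN_match v := .of_comp_injective Subtype.val_injective
    (vertexMatch_of_thin (N v) (he _) rfl (he _) rfl)
  reg_match r := Subtype.ext (Subtype.ext (U.reg_weight r))
  merge_match m := by
    have hm := he (.inr (.inr (.inr (.inr (.inr m)))))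
    refine ⟨Subtype.ext (congrArg Prod.fst hm).symm, Subtype.ext (congrArg Prod.snd hm).symm,
      Subtype.ext (Subtype.ext ((U.merge_weight m).symm.trans ?_))⟩
    exact congrArg (fun w : PosReal × PosReal => ((w.1 + w.2 : PosReal) : ℝ)) hm.symm
  split_match s := ⟨rfl, rfl, Subtype.ext (Subtype.ext (U.split_weight s).symm)⟩

end OfMatching

end TwoFoam

namespace OneFoam

variable {U V : OneFoam}

theorem nonempty_twoFoam_of_vertexSum_universalCocycle_eq_zero
    (h : U.vertexSum universalCocycle = 0) : Nonempty (TwoFoam U) := by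
  have := Fintype.ofFinite U.Split
  have := Fintype.ofFinite U.Merge
  have hmem : U.vertexSum (fun a b => .single (a, b) (1 : ℤ)) ∈
      AddSubgroup.closure (Set.range (vertexRelation (S := PosReal))) := by
    rw [← QuotientAddGroup.eq_zero_iff, ← h]
    exact U.map_vertexSum _ (QuotientAddGroup.mk' _)
  obtain ⟨n, p, N, P, hU⟩ := exists_sum_sub_sum_of_mem_closure_range hmem
  obtain ⟨e, he⟩ := exists_equiv_of_sum_single_eq (R := ℤ) (TwoFoam.initialType U P N)
    (TwoFoam.terminalType U P N) (by
      simp only [vertexSum, vertexRelation, finsum_eq_sum_of_fintype, Function.uncurry_def,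
        Finset.sum_add_distrib, Finset.sum_sub_distrib] at hU
      simp only [TwoFoam.initialType, TwoFoam.terminalType, Fintype.sum_sum_type, Sum.elim_inl,
        Sum.elim_inr, Finset.univ_eq_empty, Finset.sum_empty, Function.comp_apply]
      linear_combination (norm := module) -hU)
  exact ⟨.ofMatching e he⟩

theorem cobordant_of_vertexSum_eq
    (h : U.vertexSum universalCocycle = V.vertexSum universalCocycle) : Cobordant U V := by
  apply nonempty_twoFoam_of_vertexSum_universalCocycle_eq_zero
  rw [vertexSum_union, vertexSum_reverse, h, neg_add_cancel]

end OneFoam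

/-! ### The vertices of the one-foam of an interval exchange transformation -/

/-- The inclusion of the positive reals into the reals. -/
def coePosReal : PosReal →ₙ+ ℝ := ⟨Subtype.val, Positive.coe_add⟩

namespace PlaneTree

variable {n : ℕ} (t : PlaneTree n) (w : Fin n → PosReal)

/-- The total weight of the leaves below a leaf or an inner vertex, as a positive real number. -/
noncomputable def posWeight (x : Fin n ⊕ t.Inner) : PosReal :=
  ⟨t.weight (fun i => w i) x, t.weight_pos _ (fun i => (w i).2) x⟩

theorem posWeight_root : t.posWeight w t.root = t.fold w :=
  Subtype.ext ((t.weight_root _).trans (t.map_fold coePosReal w).symm)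

theorem innerSum_eq_finsum {M : Type*} [AddCommGroup M] (f : PosReal → PosReal → M) :
    t.innerSum f w = ∑ᶠ p, f (t.posWeight w (t.child₁ p)) (t.posWeight w (t.child₂ p)) := by
  induction t with
  | leaf => exact (finsum_of_isEmpty (α := Empty) _).symm
  | @node m n s t hs ht =>
    have := Fintype.ofFinite s.Inner
    have := Fintype.ofFinite t.Inner
    have posWeight_inLeft (x) : (node s t).posWeight w (inLeft s t x) =
        s.posWeight (w ∘ Fin.castAdd n) x := Subtype.ext (weight_inLeft s t _ x)
    have posWeight_inRight (x) : (node s t).posWeight w (inRight s t x) =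
        t.posWeight (w ∘ Fin.natAdd m) x := Subtype.ext (weight_inRight s t _ x)
    refine Eq.trans ?_ (finsum_eq_sum_of_fintype (α := Option (s.Inner ⊕ t.Inner)) _).symm
    rw [innerSum, hs, ht, Fintype.sum_option, Fintype.sum_sum_type, finsum_eq_sum_of_fintype,
      finsum_eq_sum_of_fintype, ← posWeight_root, ← posWeight_root, add_comm]
    simp only [← posWeight_inLeft, ← posWeight_inRight]
    rfl

end PlaneTree

namespace IETData

open scoped TensorProduct

variable (D : IETData)

/-- The lengths of the intervals as positive real numbers. -/
def posLen (i : Fin D.r) : PosReal := ⟨D.len i, D.len_pos i⟩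

theorem vertexSum_closedFoam {M : Type*} [AddCommGroup M] (f : PosReal → PosReal → M)
    (s m : PlaneTree D.r) : (D.closedFoam s m).vertexSum f =
      s.innerSum f D.posLen - m.innerSum f (D.posLen ∘ D.perm.symm) := by
  have posWeight_splitEdge (x) : (D.closedFoam s m).posWeight (D.splitEdge s m x) =
      s.posWeight D.posLen x := Subtype.ext (D.weight_splitEdge s m x)
  have posWeight_mergeEdge (x) : (D.closedFoam s m).posWeight (D.mergeEdge s m x) =
      m.posWeight (D.posLen ∘ D.perm.symm) x := Subtype.ext (D.weight_mergeEdge s m x)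
  simp only [PlaneTree.innerSum_eq_finsum, ← posWeight_splitEdge, ← posWeight_mergeEdge]
  rfl

theorem innerSum_tmul_posLen (τ : Equiv.Perm (Fin D.r)) (t : PlaneTree D.r) :
    t.innerSum (fun a b : PosReal => (a : ℝ) ⊗ₜ[ℤ] (b : ℝ)) (D.posLen ∘ τ.symm) =
      ∑ i, D.left τ i ⊗ₜ D.len i := by
  refine (t.innerSum_tmul coePosReal _).trans ?_
  rw [← Equiv.sum_comp τ]
  refine Finset.sum_congr rfl fun j _ => congrArg₂ _ ?_ ?_
  · rw [left, Finset.sum_filter, Finset.sum_filter, ← Equiv.sum_comp τ]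
    simp only [Function.comp_apply, Equiv.symm_apply_apply]
    rfl
  · exact congrArg D.len (τ.symm_apply_apply j)

/-- The translation by which the `i`-th interval is moved. -/
noncomputable def shift (i : Fin D.r) : ℝ := D.left D.perm i - D.left 1 i

/-- The Sah–Arnoux–Fathi invariant of an interval exchange transformation. -/
noncomputable def safInvariant : ℝ ⊗[ℤ] ℝ := ∑ i, D.shift i ⊗ₜ D.len i

theorem exists_vertexSum_closedFoam_eq {M : Type*} [AddCommGroup M] {f : PosReal → PosReal → M}
    (hf : IsTwoCocycle f) : ∃ Φ : ℝ ⊗[ℤ] ℝ →+ M, ∀ (D : IETData) (s m : PlaneTree D.r),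
      (D.closedFoam s m).vertexSum f = Φ D.safInvariant := by
  obtain ⟨Φ, symm⟩ := hf.exists_symm_sub_tmul
  have isTwoCocycle_sub : IsTwoCocycle fun a b : PosReal => f a b - Φ ((a : ℝ) ⊗ₜ (b : ℝ)) := by
    intro a b c
    simp only [Positive.coe_add, TensorProduct.add_tmul, TensorProduct.tmul_add, map_add]
    linear_combination (norm := module) hf a b c
  refine ⟨-Φ, fun D s m => ?_⟩
  have h := PlaneTree.innerSum_comp_perm isTwoCocycle_sub symm s m D.posLen D.perm.symm
  rw [PlaneTree.innerSum_sub, PlaneTree.innerSum_sub, ← PlaneTree.map_innerSum,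
    ← PlaneTree.map_innerSum, innerSum_tmul_posLen] at h
  have hs : s.innerSum (fun a b : PosReal => (a : ℝ) ⊗ₜ[ℤ] (b : ℝ)) D.posLen =
      ∑ i, D.left 1 i ⊗ₜ D.len i := D.innerSum_tmul_posLen 1 s
  rw [hs] at h
  simp only [vertexSum_closedFoam, safInvariant, shift, TensorProduct.sub_tmul,
    Finset.sum_sub_distrib, AddMonoidHom.neg_apply, map_sub]
  linear_combination (norm := module) -h

end IETData

/-! ### Tensor-valued integrals of simple functions -/

section TensorIntegral

open MeasureTheory
open scoped TensorProduct

variable {α E : Type*} [MeasurableSpace α] [AddCommGroup E] {μ : Measure α}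

/-- The integral of a simple function with values in an abelian group `E`, as an element of
`E ⊗ ℝ`. -/
noncomputable def tensorIntegral (μ : Measure α) (f : SimpleFunc α E) : E ⊗[ℤ] ℝ :=
  ∑ v ∈ f.range, v ⊗ₜ μ.real (f ⁻¹' {v})

theorem tensorIntegral_eq_sum {f : SimpleFunc α E} {s : Finset E} (hs : f.range ⊆ s) :
    tensorIntegral μ f = ∑ v ∈ s, v ⊗ₜ μ.real (f ⁻¹' {v}) :=
  Finset.sum_subset hs fun v _ hv => by
    rw [(f.preimage_eq_empty_iff v).2 hv, measureReal_empty, TensorProduct.tmul_zero]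

theorem tensorIntegral_map [IsFiniteMeasure μ] {β : Type*} {f : SimpleFunc α β} (g : β → E)
    {s : Finset β} (hs : f.range ⊆ s) :
    tensorIntegral μ (f.map g) = ∑ b ∈ s, g b ⊗ₜ μ.real (f ⁻¹' {b}) := by
  classical
  have f_mem (x : α) : f x ∈ s := hs (f.mem_range_self x)
  have range_map_subset : (f.map g).range ⊆ s.image g := by
    rw [SimpleFunc.range_map]
    exact Finset.image_subset_image hs
  have preimage_map (v : E) : f.map g ⁻¹' {v} = f ⁻¹' ({b ∈ s | g b = v} : Finset β) := by
    ext x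
    simp [f_mem]
  rw [tensorIntegral_eq_sum range_map_subset,
    ← Finset.sum_fiberwise_of_maps_to fun b => Finset.mem_image_of_mem g]
  refine Finset.sum_congr rfl fun v _ => ?_
  rw [preimage_map, ← sum_measureReal_preimage_singleton _ fun b _ => f.measurableSet_fiber b,
    TensorProduct.tmul_sum]
  refine Finset.sum_congr rfl fun b hb => ?_
  rw [(Finset.mem_filter.1 hb).2]

theorem tensorIntegral_add [IsFiniteMeasure μ] (f g : SimpleFunc α E) :
    tensorIntegral μ (f + g) = tensorIntegral μ f + tensorIntegral μ g := by
  have hf : tensorIntegral μ f = _ := tensorIntegral_map (f := f.pair g) Prod.fst subset_rfl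
  have hg : tensorIntegral μ g = _ := tensorIntegral_map (f := f.pair g) Prod.snd subset_rfl
  have hfg : tensorIntegral μ (f + g) = _ :=
    tensorIntegral_map (f := f.pair g) (fun p => p.1 + p.2) subset_rfl
  simp only [hf, hg, hfg, TensorProduct.add_tmul, Finset.sum_add_distrib]

theorem tensorIntegral_comp {T : α → α} (hT : MeasurePreserving T μ μ)
    (f : SimpleFunc α E) : tensorIntegral μ (f.comp T hT.measurable) = tensorIntegral μ f := by
  rw [tensorIntegral_eq_sum (f.range_comp_subset_range hT.measurable), tensorIntegral]
  refine Finset.sum_congr rfl fun v _ => ?_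
  rw [SimpleFunc.coe_comp, Set.preimage_comp,
    hT.measureReal_preimage (f.measurableSet_fiber v).nullMeasurableSet]

end TensorIntegral

/-! ### The Sah–Arnoux–Fathi invariant -/

namespace IETData

open MeasureTheory
open scoped TensorProduct

attribute [local instance] Measure.Subtype.measureSpace

instance isFiniteMeasure_volume : IsFiniteMeasure (volume : Measure (Set.Ico (0 : ℝ) 1)) where
  measure_univ_lt_top := by
    rw [← volume_image_subtype_coe measurableSet_Ico, Set.image_univ, Subtype.range_coe]
    exact measure_Ico_lt_top

variable (D : IETData)

/-- The index of the interval that contains a given point when the intervals are put in the order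
that `τ` prescribes. -/
noncomputable def blockIndex (τ : Equiv.Perm (Fin D.r)) (x : Set.Ico (0 : ℝ) 1) : Fin D.r :=
  ((Equiv.ofBijective _ (D.place_bijective τ)).symm x).1

theorem blockIndex_place (τ : Equiv.Perm (Fin D.r)) (p : Σ i, Set.Ico (0 : ℝ) (D.len i)) :
    D.blockIndex τ (D.place τ p) = p.1 :=
  congrArg Sigma.fst ((Equiv.ofBijective _ (D.place_bijective τ)).symm_apply_apply p)

theorem blockIndex_eq_iff (τ : Equiv.Perm (Fin D.r)) (x : Set.Ico (0 : ℝ) 1) (i : Fin D.r) :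
    D.blockIndex τ x = i ↔ (x : ℝ) ∈ Set.Ico (D.left τ i) (D.left τ i + D.len i) := by
  constructor
  · rintro rfl
    obtain ⟨p, rfl⟩ := (D.place_bijective τ).2 x
    rw [blockIndex_place]
    exact ⟨le_add_of_nonneg_right p.2.2.1, add_lt_add_right p.2.2.2 _⟩
  · intro hx
    have place_eq :
        D.place τ ⟨i, x - D.left τ i, sub_nonneg.2 hx.1, sub_lt_iff_lt_add'.2 hx.2⟩ = x :=
      Subtype.ext (add_sub_cancel _ _)
    rw [← place_eq, blockIndex_place]

theorem blockIndex_preimage (τ : Equiv.Perm (Fin D.r)) (i : Fin D.r) :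
    D.blockIndex τ ⁻¹' {i} = (↑) ⁻¹' Set.Ico (D.left τ i) (D.left τ i + D.len i) :=
  Set.ext fun x => D.blockIndex_eq_iff τ x i

theorem measurableSet_blockIndex_preimage (τ : Equiv.Perm (Fin D.r)) (i : Fin D.r) :
    MeasurableSet (D.blockIndex τ ⁻¹' {i}) := by
  rw [blockIndex_preimage]
  exact measurable_subtype_coe measurableSet_Ico

theorem volume_blockIndex_preimage (τ : Equiv.Perm (Fin D.r)) (i : Fin D.r) :
    volume.real (D.blockIndex τ ⁻¹' {i}) = D.len i := by
  have block_subset : Set.Ico (D.left τ i) (D.left τ i + D.len i) ⊆ Set.Ico 0 1 :=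
    Set.Ico_subset_Ico (D.left_nonneg τ i) (D.left_add_len_le_one τ i)
  rw [blockIndex_preimage, measureReal_def, volume_preimage_coe measurableSet_Ico.nullMeasurableSet
    measurableSet_Ico, Set.inter_eq_left.2 block_subset, Real.volume_Ico, add_sub_cancel_left,
    ENNReal.toReal_ofReal (D.len_pos i).le]

theorem blockIndex_map (x : Set.Ico (0 : ℝ) 1) :
    D.blockIndex D.perm (D.map x) = D.blockIndex 1 x := by
  obtain ⟨p, rfl⟩ := (D.place_bijective 1).2 x
  rw [map_place, blockIndex_place, blockIndex_place]

theorem coe_map (x : Set.Ico (0 : ℝ) 1) : (D.map x : ℝ) = x + D.shift (D.blockIndex 1 x) := by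
  obtain ⟨p, rfl⟩ := (D.place_bijective 1).2 x
  rw [map_place, blockIndex_place]
  simp only [place, shift]
  ring

theorem measurable_blockIndex (τ : Equiv.Perm (Fin D.r)) : Measurable (D.blockIndex τ) :=
  measurable_to_countable' (D.measurableSet_blockIndex_preimage τ)

theorem measurable_map : Measurable D.map := by
  refine (MeasurableEmbedding.subtype_coe measurableSet_Ico).measurable_comp_iff.1 ?_
  have coe_comp_map : ((↑) : Set.Ico (0 : ℝ) 1 → ℝ) ∘ D.map =
      fun x : Set.Ico (0 : ℝ) 1 => (x : ℝ) + D.shift (D.blockIndex 1 x) := funext D.coe_map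
  rw [coe_comp_map]
  have measurable_shift : Measurable D.shift := .of_discrete
  exact measurable_subtype_coe.add (measurable_shift.comp (D.measurable_blockIndex 1))

theorem volume_preimage_map_inter {A : Set (Set.Ico (0 : ℝ) 1)} (i : Fin D.r) :
    volume (D.map ⁻¹' A ∩ D.blockIndex 1 ⁻¹' {i}) = volume (A ∩ D.blockIndex D.perm ⁻¹' {i}) := by
  have image_coe : ((↑) '' (D.map ⁻¹' A ∩ D.blockIndex 1 ⁻¹' {i}) : Set ℝ) =
      (· + D.shift i) ⁻¹' ((↑) '' (A ∩ D.blockIndex D.perm ⁻¹' {i})) := by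
    ext x
    constructor
    · rintro ⟨x, ⟨hxA, rfl⟩, rfl⟩
      exact ⟨D.map x, ⟨hxA, D.blockIndex_map x⟩, D.coe_map x⟩
    · rintro ⟨y, ⟨hyA, hy⟩, hxy⟩
      obtain ⟨x', rfl⟩ := D.map.surjective y
      rw [Set.mem_preimage, blockIndex_map] at hy
      rw [coe_map, hy] at hxy
      exact ⟨x', ⟨hyA, hy⟩, add_right_cancel hxy⟩
  rw [← volume_image_subtype_coe measurableSet_Ico, image_coe, measure_preimage_add_right,
    volume_image_subtype_coe measurableSet_Ico]

theorem sum_volume_inter_blockIndex (τ : Equiv.Perm (Fin D.r)) (A : Set (Set.Ico (0 : ℝ) 1)) :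
    ∑ i, volume (A ∩ D.blockIndex τ ⁻¹' {i}) = volume A := by
  have h := sum_measure_preimage_singleton (μ := volume.restrict A) Finset.univ
    fun i _ => D.measurableSet_blockIndex_preimage τ i
  simpa [Measure.restrict_apply (D.measurableSet_blockIndex_preimage τ _), Set.inter_comm] using h

theorem measurePreserving_map : MeasurePreserving D.map := by
  refine ⟨D.measurable_map, Measure.ext fun A hA => ?_⟩
  rw [Measure.map_apply D.measurable_map hA, ← D.sum_volume_inter_blockIndex 1,
    ← D.sum_volume_inter_blockIndex D.perm A]
  exact Finset.sum_congr rfl fun i _ => D.volume_preimage_map_inter i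

/-- The function by which an interval exchange transformation moves the points. -/
noncomputable def displacement : SimpleFunc (Set.Ico (0 : ℝ) 1) ℝ :=
  (⟨D.blockIndex 1, D.measurableSet_blockIndex_preimage 1, Set.toFinite _⟩ :
    SimpleFunc _ (Fin D.r)).map D.shift

theorem displacement_apply (x : Set.Ico (0 : ℝ) 1) : D.displacement x = D.map x - x :=
  eq_sub_of_add_eq' (D.coe_map x).symm

theorem tensorIntegral_displacement :
    tensorIntegral volume D.displacement = D.safInvariant := by
  rw [displacement, tensorIntegral_map _ (Finset.subset_univ _)]
  exact Finset.sum_congr rfl fun i _ => congrArg _ (D.volume_blockIndex_preimage 1 i)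

variable {D} {D' D'' : IETData}

theorem safInvariant_congr (h : D.map = D'.map) : D.safInvariant = D'.safInvariant := by
  rw [← tensorIntegral_displacement, ← tensorIntegral_displacement]
  congr 1
  ext x
  rw [displacement_apply, displacement_apply, h]

theorem safInvariant_comp (h : D''.map = D'.map ∘ D.map) :
    D''.safInvariant = D.safInvariant + D'.safInvariant := by
  have displacement_comp : D''.displacement =
      D.displacement + D'.displacement.comp D.map D.measurePreserving_map.measurable := by
    ext x
    change D''.displacement x = D.displacement x + D'.displacement (D.map x)
    rw [displacement_apply, displacement_apply, displacement_apply, h]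
    exact (sub_add_sub_cancel' _ _ _).symm
  rw [← tensorIntegral_displacement, displacement_comp, tensorIntegral_add,
    tensorIntegral_comp D.measurePreserving_map, tensorIntegral_displacement,
    tensorIntegral_displacement]

end IETData

/-! ### The homomorphism to the cobordism group -/

theorem PlaneTree.nonempty_of_pos {n : ℕ} (hn : 0 < n) : Nonempty (PlaneTree n) := by
  induction n, hn using Nat.le_induction with
  | base => exact ⟨.leaf⟩
  | succ n _ ih => exact ih.map fun t => .node t .leaf

namespace IETData

variable {D D' D'' : IETData}

theorem r_pos (D : IETData) : 0 < D.r := by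
  refine Nat.pos_of_ne_zero fun h => ?_
  have : IsEmpty (Fin D.r) := by rw [h]; infer_instance
  simpa using D.len_sum

theorem cobordant_closedFoam_of_map_eq (h : D.map = D'.map) (s m : PlaneTree D.r)
    (s' m' : PlaneTree D'.r) : Cobordant (D.closedFoam s m) (D'.closedFoam s' m') := by
  obtain ⟨Φ, hΦ⟩ := exists_vertexSum_closedFoam_eq isTwoCocycle_universalCocycle
  refine OneFoam.cobordant_of_vertexSum_eq ?_
  rw [hΦ, hΦ, safInvariant_congr h]

theorem cobordant_closedFoam_of_map_eq_comp (h : D''.map = D'.map ∘ D.map) (s m : PlaneTree D.r)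
    (s' m' : PlaneTree D'.r) (s'' m'' : PlaneTree D''.r) :
    Cobordant (D''.closedFoam s'' m'') ((D.closedFoam s m).union (D'.closedFoam s' m')) := by
  obtain ⟨Φ, hΦ⟩ := exists_vertexSum_closedFoam_eq isTwoCocycle_universalCocycle
  refine OneFoam.cobordant_of_vertexSum_eq ?_
  rw [OneFoam.vertexSum_union, hΦ, hΦ, hΦ, safInvariant_comp h, map_add]

end IETData

theorem mainTheorem10 :
    (∀ (D D' D'' : IETData), D''.map = D'.map ∘ D.map →
      ∀ (s m : PlaneTree D.r) (s' m' : PlaneTree D'.r) (s'' m'' : PlaneTree D''.r),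
        Cobordant (D''.closedFoam s'' m'')
          ((D.closedFoam s m).union (D'.closedFoam s' m'))) ∧
    ∃ φ : AutIET →* Multiplicative Cob, ∀ (D : IETData) (s m : PlaneTree D.r),
      φ D.toAut = Multiplicative.ofAdd (Cob.mk (D.closedFoam s m)) := by
  refine ⟨fun D D' D'' h => IETData.cobordant_closedFoam_of_map_eq_comp h, ?_⟩
  choose data map_data using fun f : AutIET => f.2
  let tree (f : AutIET) := (PlaneTree.nonempty_of_pos (data f).r_pos).some
  let foam (f : AutIET) := (data f).closedFoam (tree f) (tree f)
  have cobordant_mul (f g : AutIET) : Cobordant (foam (f * g)) ((foam g).union (foam f)) := by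
    refine IETData.cobordant_closedFoam_of_map_eq_comp ?_ _ _ _ _ _ _
    rw [map_data, map_data, map_data]
    rfl
  have mk_mul (f g : AutIET) : Cob.mk (foam (f * g)) = Cob.mk (foam f) + Cob.mk (foam g) := by
    rw [add_comm]
    exact Quotient.sound (cobordant_mul f g)
  refine ⟨MonoidHom.mk' (fun f => .ofAdd (Cob.mk (foam f))) fun f g => congrArg _ (mk_mul f g), ?_⟩
  exact fun D s m => congrArg Multiplicative.ofAdd (Quotient.sound
    (IETData.cobordant_closedFoam_of_map_eq (map_data D.toAut) _ _ _ _))
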